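/- Let $b\in\mathbb C$ with $\operatorname{Re} b>-1/2$, let $H$ be an entire function without zeros in $\mathbb C\setminus\{0,1\}$, and let $$\nu(z)=(-z)^{-\overline b}(1-z)^{b+\overline b}H(z)$$ (principal powers for $z\in\mathbb T\setminus\{1\}$, where $\mathbb T$ is the positively oriented unit circle). Let $\{\Phi_k\}_{k\ge0}$, $\{\Psi_k\}_{k\ge0}$ be monic polynomials, $\deg\Phi_k=\deg\Psi_k=k$, with $$\int_{\mathbb T}\Phi_k(z)\overline{\Psi_m(z)}\,\frac{\nu(z)}{\mathrm i z}\,\mathrm dz=\kappa_k^{-2}\,\delta_{k,m},\qquad \kappa_k^{-2}\in\mathbb C\setminus\{0\},\quad k,m\ge 0 ;$$ if $\nu$ is a positive weight on $\mathbb T$ then $\Psi_k=\Phi_k$ are the monic orthogonal polynomials on the unit circle and $\kappa_k>0$. Put $\Psi_k^*(z)=z^k\,\overline{\Psi_k(1/\overline z)}$ and, for $n\ge1$ and $z\in\mathbb C\setminus\mathbb T$, $$Y_n(z)=\begin{bmatrix}\Phi_n(z)&\dfrac1{2\pi \mathrm i}\displaystyle\int_{\mathbb T}\frac{\Phi_n(t)}{t-z}\frac{\nu(t)}{t^n}\,\mathrm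 dt\\[2mm]-2\pi\kappa_{n-1}^2\Psi_{n-1}^*(z)&-2\pi\kappa_{n-1}^2\,\dfrac1{2\pi \mathrm i}\displaystyle\int_{\mathbb T}\frac{\Psi^*_{n-1}(t)}{t-z}\frac{\nu(t)}{t^n}\,\mathrm dt\end{bmatrix},\qquad C_n(z)=\begin{bmatrix}z^{-n/2}\nu(z)^{1/2}&0\\0&z^{n/2}\nu(z)^{-1/2}\end{bmatrix},$$ $Z_n=Y_nC_n$ and $M_n=Z_n'Z_n^{-1}$ on $\mathbb C\setminus(\mathbb T\cup\{0\})$, where near each point any holomorphic branches of the powers in $C_n$ are taken. Then, for every $n\ge1$, $M_n$ does not depend on the choice of the branches and extends to a holomorphic matrix function on $\mathbb C\setminus\{0,1\}$, which has a simple pole at $z=0$ and either a removable singularity or a simple pole at $z=1$. -/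

import Mathlib

open Complex Polynomial Topology Filter ComplexConjugate

/-- The generalized modified Jacobi weight `ν(z) = (-z)^{-b̄} (1-z)^{b+b̄} H(z)`, with principal
powers. On the unit circle, `z = e^{iθ}` with `0 < θ < 2π`, both powers are away from their cuts and
`(-z)^{-b̄} (1-z)^{b+b̄} = e^{-η(θ-π)} (2 sin (θ/2))^{2λ}` for `b = λ + iη`. -/
noncomputable def jacobiWeight (b : ℂ) (H : ℂ → ℂ) (z : ℂ) : ℂ :=
  (-z) ^ (-conj b) * (1 - z) ^ (b + conj b) * H z

/-- `Φ` and `Ψ` are the two sequences of monic polynomials, biorthogonal on the unit circle for the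
(possibly complex) weight `ν`:
`∫_𝕋 Φ_k(z) conj(Ψ_m(z)) ν(z)/(iz) dz = h_k δ_{k,m}` with `h_k ≠ 0`.
For a positive weight `Ψ = Φ` is the sequence of monic orthogonal polynomials and
`h_k = κ_k⁻²`. -/
structure IsBiorthogonal (ν : ℂ → ℂ) (Φ Ψ : ℕ → ℂ[X]) (h : ℕ → ℂ) : Prop where
  monic_left : ∀ k, (Φ k).Monic
  monic_right : ∀ k, (Ψ k).Monic
  degree_left : ∀ k, (Φ k).natDegree = k
  degree_right : ∀ k, (Ψ k).natDegree = k
  norm_ne_zero : ∀ k, h k ≠ 0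
  orthogonal : ∀ k m,
    (∮ z in C(0, 1), (Φ k).eval z * conj ((Ψ m).eval z) * (ν z / (I * z)))
      = if k = m then h k else 0

/-- The reciprocal polynomial `P^*(z) = z^k conj(P(1/z̄))` of a polynomial `P` of degree `k`. -/
noncomputable def recip (k : ℕ) (P : ℂ[X]) : ℂ[X] :=
  (P.map (starRingEnd ℂ)).reflect k

/-- The function `z ↦ (1/2πi) ∫_𝕋 P(t)/(t-z) ν(t)/t^n dt` associated with a polynomial `P`. -/
noncomputable def assocFun (ν : ℂ → ℂ) (n : ℕ) (P : ℂ[X]) (z : ℂ) : ℂ :=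
  (2 * Real.pi * I)⁻¹ * ∮ t in C(0, 1), P.eval t / (t - z) * (ν t / t ^ n)

/-- The matrix `Y_n` (for `n ≥ 1`, off the unit circle), with `b_{n-1} = 2π / h_{n-1}`
in the role of `2π κ_{n-1}²`. -/
noncomputable def Ymat (ν : ℂ → ℂ) (Φ Ψ : ℕ → ℂ[X]) (h : ℕ → ℂ) (n : ℕ) (z : ℂ) :
    Matrix (Fin 2) (Fin 2) ℂ :=
  !![(Φ n).eval z, assocFun ν n (Φ n) z;
     -(2 * Real.pi / h (n - 1)) * (recip (n - 1) (Ψ (n - 1))).eval z,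
     -(2 * Real.pi / h (n - 1)) * assocFun ν n (recip (n - 1) (Ψ (n - 1))) z]

/-- `C` is, near `z₀`, a holomorphic determination of
`C_n(z) = diag(z^{-n/2} ν(z)^{1/2}, z^{n/2} ν(z)^{-1/2})`: the functions `L₀`, `L₁`, `L₂` are
holomorphic logarithms of `z`, `-z`, `1 - z` near `z₀` and `r` is a holomorphic square root of
`ν(z) = (-z)^{-b̄} (1-z)^{b+b̄} H(z)`, with the powers taken through these logarithms. -/
def IsCBranchAt (b : ℂ) (H : ℂ → ℂ) (n : ℕ) (z₀ : ℂ) (C : ℂ → Matrix (Fin 2) (Fin 2) ℂ) : Prop :=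
  ∃ L₀ L₁ L₂ r : ℂ → ℂ,
    AnalyticAt ℂ L₀ z₀ ∧ AnalyticAt ℂ L₁ z₀ ∧ AnalyticAt ℂ L₂ z₀ ∧ AnalyticAt ℂ r z₀ ∧
    ∀ᶠ z in 𝓝 z₀,
      exp (L₀ z) = z ∧ exp (L₁ z) = -z ∧ exp (L₂ z) = 1 - z ∧
      r z ^ 2 = exp (-conj b * L₁ z) * exp ((b + conj b) * L₂ z) * H z ∧
      C z = !![exp (-(n / 2 : ℂ) * L₀ z) * r z, 0; 0, exp ((n / 2 : ℂ) * L₀ z) * (r z)⁻¹]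

/-- The entrywise derivative of a matrix function. -/
noncomputable def matDeriv (Z : ℂ → Matrix (Fin 2) (Fin 2) ℂ) (z : ℂ) : Matrix (Fin 2) (Fin 2) ℂ :=
  Matrix.of fun i j => deriv (fun w => Z w i j) z

/-- `m` is the value at `z₀` of the structure matrix `M_n = Z_n' Z_n⁻¹`, where `Z_n = Y_n C_n`:
there are holomorphic determinations of `C_n` near `z₀` and each of them yields `m`. -/
def IsStructureMatrixAt (b : ℂ) (H : ℂ → ℂ) (Φ Ψ : ℕ → ℂ[X]) (h : ℕ → ℂ) (n : ℕ) (z₀ : ℂ)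
    (m : Matrix (Fin 2) (Fin 2) ℂ) : Prop :=
  (∃ C, IsCBranchAt b H n z₀ C) ∧
  ∀ C, IsCBranchAt b H n z₀ C →
    m = matDeriv (fun z => Ymat (jacobiWeight b H) Φ Ψ h n z * C z) z₀ *
      (Ymat (jacobiWeight b H) Φ Ψ h n z₀ * C z₀)⁻¹

/-- The matrix function `M` has a removable singularity at `z₀`. -/
def HasRemovableSingularityAt (M : ℂ → Matrix (Fin 2) (Fin 2) ℂ) (z₀ : ℂ) : Prop :=
  ∀ i j, MeromorphicAt (fun z => M z i j) z₀ ∧ 0 ≤ meromorphicOrderAt (fun z => M z i j) z₀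

/-- The matrix function `M` has a simple pole at `z₀`: no entry has a pole of order greater than
one, and some entry has a pole of order one. -/
def HasSimplePoleAt (M : ℂ → Matrix (Fin 2) (Fin 2) ℂ) (z₀ : ℂ) : Prop :=
  (∀ i j, MeromorphicAt (fun z => M z i j) z₀ ∧ -1 ≤ meromorphicOrderAt (fun z => M z i j) z₀) ∧
  ∃ i j, meromorphicOrderAt (fun z => M z i j) z₀ = -1

/-! Write `q = z(1-z)` and `w = ν(t)/t^n`. The zeros of `H` lie in `{0, 1}`, so `q H'/H` is entire,
and the density satisfies a Pearson equation `q w' = V w` with `V` entire. Every branch of `C_n` is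
diagonal with logarithmic derivatives `±V/(2q)`. Hence `M_n = Y' Y⁻¹ + (V/2q) Y diag(1,-1) Y⁻¹`,
independently of the branch.

Biorthogonality gives `det Y = 1` (`IsBiorthogonal.wronskian`). The entries of `q M_n` are therefore
constant multiples of bilinear expressions `q (f' F_g - F_f' g) + (V/2)(f F_g + F_f g)`, where `f,
g` are among `P = Φ_n` and `R = Ψ*_{n-1}`, and `F` denotes the Cauchy transform.

These expressions have no jump across the circle. Integration by parts turns `q F_f'` into the
Cauchy transform of `q f' + V f` minus a moment (`pearson_cauchyTransform`), and every `F_f` is an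
entire function plus `f F_1` (`cauchyTransform_eq`). The coefficients of `F_1` cancel, leaving an
entire function (`pearsonBilin_eq`). So `M_n = N/q` with `N` entire, and its poles at 0 and 1 are at
most simple.

At 0 the matrix `N(0)` is conjugate to `(V(0)/2) diag(1,-1)`, so it is nonzero once `V(0) = p - n -
b̄` is, `p` being the order of `H` at 0. If `V(0)` vanished, `ν(t)/t` would agree on the circle with
an entire function and the zeroth norm would be 0 (`IsBiorthogonal.exponent_ne_zero`). -/

/-! ### Circle integrals depending on a parameter -/

/-- Differentiation under a circle integral of a kernel that is holomorphic and bounded in the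
parameter, against an integrable density. -/
theorem hasDerivAt_circleIntegral_of_bounded {w : ℂ → ℂ} (hw : CircleIntegrable w 0 1)
    {K : ℂ → ℂ → ℂ} {z₀ : ℂ} {r B : ℝ} (hr : 0 < r)
    (hcont : ∀ z ∈ Metric.ball z₀ r, ContinuousOn (K z) (Metric.sphere 0 1))
    (hdiff : ∀ t ∈ Metric.sphere (0 : ℂ) 1,
      DifferentiableOn ℂ (fun z => K z t) (Metric.ball z₀ r))
    (hB : ∀ z ∈ Metric.ball z₀ r, ∀ t ∈ Metric.sphere (0 : ℂ) 1, ‖K z t‖ ≤ B) :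
    HasDerivAt (fun z => ∮ t in C(0, 1), K z t * w t)
      (∮ t in C(0, 1), deriv (fun z => K z t) z₀ * w t) z₀ := by
  have hsph : ∀ θ : ℝ, circleMap 0 1 θ ∈ Metric.sphere (0 : ℂ) 1 :=
    fun θ => circleMap_mem_sphere 0 zero_le_one θ
  have hw' : IntervalIntegrable (fun θ => w (circleMap 0 1 θ)) MeasureTheory.volume 0
      (2 * Real.pi) := hw
  have hK : ∀ z ∈ Metric.ball z₀ r, Continuous fun θ : ℝ => K z (circleMap 0 1 θ) :=
    fun z hz => (hcont z hz).comp_continuous (continuous_circleMap 0 1) hsph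
  have hd : Continuous (deriv (circleMap 0 1)) := by
    simp_rw [funext (deriv_circleMap 0 1)]
    fun_prop
  have hz₀ : z₀ ∈ Metric.ball z₀ r := Metric.mem_ball_self hr
  have hF : ∀ z ∈ Metric.ball z₀ r, IntervalIntegrable
      (fun θ : ℝ => deriv (circleMap 0 1) θ • (K z (circleMap 0 1 θ) * w (circleMap 0 1 θ)))
      MeasureTheory.volume 0 (2 * Real.pi) := fun z hz =>
    (hw'.continuousOn_mul (hK z hz).continuousOn).continuousOn_mul hd.continuousOn
  have hDat : ∀ z ∈ Metric.ball z₀ r, ∀ t ∈ Metric.sphere (0 : ℂ) 1,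
      DifferentiableAt ℂ (fun z => K z t) z := fun z hz t ht =>
    (hdiff t ht).differentiableAt (Metric.isOpen_ball.mem_nhds hz)
  -- No joint regularity of the kernel is assumed, so its derivative is obtained as a pointwise
  -- limit of difference quotients, each continuous in `θ`.
  have hmeas : Measurable fun θ : ℝ => deriv (fun z => K z (circleMap 0 1 θ)) z₀ := by
    have hlim : ∀ θ : ℝ, Tendsto (fun k : ℕ => slope (fun z => K z (circleMap 0 1 θ)) z₀
        (z₀ + (r / 2 / (k + 1) : ℝ))) atTop
        (𝓝 (deriv (fun z => K z (circleMap 0 1 θ)) z₀)) := by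
      intro θ
      have h1 := (hasDerivAt_iff_tendsto_slope.1 (hDat z₀ hz₀ _ (hsph θ)).hasDerivAt)
      refine h1.comp (tendsto_nhdsWithin_iff.2 ⟨?_, Eventually.of_forall fun k => ?_⟩)
      · have h2 : Tendsto (fun k : ℕ => (r / 2 / (k + 1) : ℝ)) atTop (𝓝 0) := by
          have := (tendsto_one_div_add_atTop_nhds_zero_nat (𝕜 := ℝ)).const_mul (r / 2)
          simpa [div_eq_mul_inv] using this
        have h3 := (Complex.continuous_ofReal.tendsto 0).comp h2
        simpa using h3.const_add z₀
      · have : (0 : ℝ) < r / 2 / (k + 1) := by positivity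
        simp only [Set.mem_compl_iff, Set.mem_singleton_iff, add_eq_left, ofReal_eq_zero]
        exact this.ne'
    refine measurable_of_tendsto_metrizable (f := fun (k : ℕ) (θ : ℝ) =>
      slope (fun z => K z (circleMap 0 1 θ)) z₀ (z₀ + (r / 2 / (k + 1) : ℝ))) (fun k => ?_)
      (tendsto_pi_nhds.2 hlim)
    have hk : z₀ + (r / 2 / (k + 1) : ℝ) ∈ Metric.ball z₀ r := by
      have h0 : (0 : ℝ) < r / 2 / (k + 1) := by positivity
      have h1 : r / 2 / (k + 1) ≤ r / 2 := div_le_self (by positivity) (by simp)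
      rw [mem_ball_iff_norm, add_sub_cancel_left, Complex.norm_real, Real.norm_of_nonneg h0.le]
      linarith
    simp only [slope_def_field]
    exact (((hK _ hk).sub (hK _ hz₀)).div_const _).measurable
  -- Cauchy's estimate: circles of radius `r / 4` about points of the half ball stay inside the ball
  -- where `B` bounds the kernel.
  have hbound : ∀ z ∈ Metric.ball z₀ (r / 2), ∀ t ∈ Metric.sphere (0 : ℂ) 1,
      ‖deriv (fun z => K z t) z‖ ≤ B / (r / 4) := by
    intro z hz t ht
    have hsub : Metric.closedBall z (r / 4) ⊆ Metric.ball z₀ r := by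
      intro y hy
      rw [Metric.mem_closedBall] at hy
      rw [Metric.mem_ball] at hz ⊢
      linarith [dist_triangle y z z₀]
    refine Complex.norm_deriv_le_of_forall_mem_sphere_norm_le (by positivity) ?_ fun y hy =>
      hB y (hsub (Metric.sphere_subset_closedBall hy)) t ht
    exact ((hdiff t ht).mono hsub).diffContOnCl_ball subset_rfl
  have key := intervalIntegral.hasDerivAt_integral_of_dominated_loc_of_deriv_le
    (μ := MeasureTheory.volume) (a := 0) (b := 2 * Real.pi)
    (F := fun z θ => deriv (circleMap 0 1) θ • (K z (circleMap 0 1 θ) * w (circleMap 0 1 θ)))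
    (F' := fun z θ => deriv (circleMap 0 1) θ •
      (deriv (fun z => K z (circleMap 0 1 θ)) z * w (circleMap 0 1 θ)))
    (x₀ := z₀) (s := Metric.ball z₀ (r / 2)) (bound := fun θ => B / (r / 4) *
      ‖w (circleMap 0 1 θ)‖) (Metric.ball_mem_nhds z₀ (by positivity)) ?_ (hF z₀ hz₀) ?_ ?_ ?_ ?_
  · exact key.2
  · filter_upwards [Metric.ball_mem_nhds z₀ hr] with z hz
    exact (intervalIntegrable_iff.1 (hF z hz)).aestronglyMeasurable
  · exact hd.measurable.aestronglyMeasurable.smul (hmeas.aestronglyMeasurable.mul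
      (intervalIntegrable_iff.1 hw').aestronglyMeasurable)
  · refine Eventually.of_forall fun θ _ z hz => ?_
    have h1 : ‖deriv (circleMap 0 1) θ‖ = 1 := by simp [deriv_circleMap]
    rw [norm_smul, h1, one_mul, norm_mul]
    exact mul_le_mul_of_nonneg_right (hbound z hz _ (hsph θ)) (norm_nonneg _)
  · exact hw'.norm.const_mul _
  · refine Eventually.of_forall fun θ _ z hz => ?_
    have hz' : z ∈ Metric.ball z₀ r := Metric.ball_subset_ball (by linarith) hz
    exact ((hDat z hz' _ (hsph θ)).hasDerivAt.mul_const _).const_mul _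

/-! ### Cauchy transforms and their entire parts -/

/-- The Cauchy transform of `f w` over the unit circle, without the factor `1 / 2πi`. -/
noncomputable def cauchyTransform (w f : ℂ → ℂ) (z : ℂ) : ℂ :=
  ∮ t in C(0, 1), f t / (t - z) * w t

/-- The integral over the unit circle of the divided difference of `f` against `w`. -/
noncomputable def slopeTransform (w f : ℂ → ℂ) (z : ℂ) : ℂ :=
  ∮ t in C(0, 1), dslope f z t * w t

theorem sub_ne_zero_of_mem_sphere {t z : ℂ} (ht : t ∈ Metric.sphere (0 : ℂ) 1) (hz : ‖z‖ ≠ 1) :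
    t - z ≠ 0 := by
  intro h
  rw [sub_eq_zero] at h
  subst h
  exact hz (by simpa using ht)

theorem differentiable_dslope {f : ℂ → ℂ} (hf : Differentiable ℂ f) (c : ℂ) :
    Differentiable ℂ (dslope f c) :=
  differentiableOn_univ.1 ((Complex.differentiableOn_dslope univ_mem).2 hf.differentiableOn)

theorem dslope_comm (f : ℂ → ℂ) (z t : ℂ) : dslope f z t = dslope f t z := by
  rcases eq_or_ne z t with rfl | h
  · rfl
  · rw [dslope_of_ne _ h.symm, dslope_of_ne _ h, slope_comm]

/-- The divided difference is symmetric, so it is entire in `z` too, and the mean value inequality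
bounds it by the supremum of `|f'|` on a disc. This also covers `z` on the circle, which makes it
the device for continuing across. -/
theorem differentiable_slopeTransform {w f : ℂ → ℂ} (hw : CircleIntegrable w 0 1)
    (hf : Differentiable ℂ f) : Differentiable ℂ (slopeTransform w f) := by
  intro z₀
  -- A convex set containing both the unit circle and the unit ball about `z₀`.
  obtain ⟨B, hB⟩ := (isCompact_closedBall (0 : ℂ) (‖z₀‖ + 2)).exists_bound_of_continuousOn
    (hf.deriv.continuous.continuousOn)
  refine (hasDerivAt_circleIntegral_of_bounded hw (K := fun z t => dslope f z t) (r := 1) (B := B)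
    one_pos (fun z _ => (differentiable_dslope hf z).continuous.continuousOn)
    (fun t _ => ?_) fun z hz t ht => ?_).differentiableAt
  · simp_rw [dslope_comm f _ t]
    exact (differentiable_dslope hf t).differentiableOn
  · have hzm : z ∈ Metric.closedBall (0 : ℂ) (‖z₀‖ + 2) := by
      rw [mem_ball_iff_norm] at hz
      rw [mem_closedBall_zero_iff]
      linarith [norm_le_norm_add_norm_sub' z z₀]
    have htm : t ∈ Metric.closedBall (0 : ℂ) (‖z₀‖ + 2) := by
      rw [mem_sphere_zero_iff_norm] at ht
      rw [mem_closedBall_zero_iff]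
      linarith [norm_nonneg z₀]
    rcases eq_or_ne t z with rfl | h
    · rw [dslope_same]
      exact hB t htm
    · have h1 := (convex_closedBall (0 : ℂ) (‖z₀‖ + 2)).norm_image_sub_le_of_norm_deriv_le
        (fun x _ => hf x) hB hzm htm
      rw [dslope_of_ne _ h, slope_def_field, norm_div,
        div_le_iff₀ (norm_pos_iff.2 (sub_ne_zero.2 h))]
      exact h1

theorem circleIntegrable_continuousOn_mul {w g : ℂ → ℂ} (hw : CircleIntegrable w 0 1)
    (hg : ContinuousOn g (Metric.sphere 0 1)) : CircleIntegrable (fun t => g t * w t) 0 1 :=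
  hw.continuousOn_mul (by simpa using hg)

/-- Splitting `f t = (f t - f z) + f z` shows that the non-entire behaviour of every transform is
carried by the single function `cauchyTransform w 1`. -/
theorem cauchyTransform_eq {w f : ℂ → ℂ} (hw : CircleIntegrable w 0 1) (hf : Continuous f)
    {z : ℂ} (hz : ‖z‖ ≠ 1) :
    cauchyTransform w f z = slopeTransform w f z + f z * cauchyTransform w 1 z := by
  have hs : ∀ t ∈ Metric.sphere (0 : ℂ) 1, t - z ≠ 0 := fun t ht =>
    sub_ne_zero_of_mem_sphere ht hz
  have h1 : CircleIntegrable (fun t => (f t - f z) / (t - z) * w t) 0 1 :=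
    circleIntegrable_continuousOn_mul hw
      (ContinuousOn.div (by fun_prop) (by fun_prop) hs)
  have h2 : CircleIntegrable (fun t => f z / (t - z) * w t) 0 1 :=
    circleIntegrable_continuousOn_mul hw
      (ContinuousOn.div (by fun_prop) (by fun_prop) hs)
  have h3 : slopeTransform w f z = ∮ t in C(0, 1), (f t - f z) / (t - z) * w t := by
    refine circleIntegral.integral_congr zero_le_one fun t ht => ?_
    rw [dslope_of_ne _ (sub_ne_zero.1 (hs t ht)), slope_def_field]
  rw [h3, cauchyTransform, cauchyTransform, ← circleIntegral.integral_const_mul]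
  have h4 : (∮ t in C(0, 1), f z * ((1 : ℂ → ℂ) t / (t - z) * w t))
      = ∮ t in C(0, 1), f z / (t - z) * w t := by
    congr 1; ext t; simp only [Pi.one_apply]; ring
  rw [h4, ← circleIntegral.integral_add h1 h2]
  congr 1; ext t; ring

theorem hasDerivAt_cauchyTransform {w f : ℂ → ℂ} (hw : CircleIntegrable w 0 1)
    (hf : Continuous f) {z : ℂ} (hz : ‖z‖ ≠ 1) :
    HasDerivAt (cauchyTransform w f) (∮ t in C(0, 1), f t / (t - z) ^ 2 * w t) z := by
  obtain ⟨B, hB⟩ := (isCompact_sphere (0 : ℂ) 1).exists_bound_of_continuousOn hf.continuousOn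
  set d := |1 - ‖z‖| with hd
  have hd0 : 0 < d := abs_pos.2 (sub_ne_zero.2 hz.symm)
  have hfar : ∀ y ∈ Metric.ball z (d / 2), ∀ t ∈ Metric.sphere (0 : ℂ) 1, d / 2 ≤ ‖t - y‖ := by
    intro y hy t ht
    rw [mem_ball_iff_norm] at hy
    rw [mem_sphere_zero_iff_norm] at ht
    have h1 : d ≤ ‖t - z‖ := by
      have := abs_norm_sub_norm_le t z
      rwa [ht] at this
    have h2 : ‖t - z‖ ≤ ‖t - y‖ + ‖y - z‖ := norm_sub_le_norm_sub_add_norm_sub t y z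
    linarith
  have hne : ∀ y ∈ Metric.ball z (d / 2), ∀ t ∈ Metric.sphere (0 : ℂ) 1, t - y ≠ 0 :=
    fun y hy t ht => norm_pos_iff.1 ((by positivity : 0 < d / 2).trans_le (hfar y hy t ht))
  have hdat : ∀ y ∈ Metric.ball z (d / 2), ∀ t ∈ Metric.sphere (0 : ℂ) 1,
      HasDerivAt (fun y => f t / (t - y)) (f t / (t - y) ^ 2) y := by
    intro y hy t ht
    have h1 := ((hasDerivAt_id y).const_sub t).inv (hne y hy t ht)
    have h2 := h1.const_mul (f t)
    simpa [div_eq_mul_inv] using h2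
  have key := hasDerivAt_circleIntegral_of_bounded hw (K := fun y t => f t / (t - y)) (z₀ := z)
    (r := d / 2) (B := B / (d / 2)) (by positivity)
    (fun y hy => ContinuousOn.div (by fun_prop) (by fun_prop) (hne y hy))
    (fun t ht y hy => (hdat y hy t ht).differentiableAt.differentiableWithinAt) ?_
  · refine key.congr_deriv (circleIntegral.integral_congr zero_le_one fun t ht => ?_)
    rw [(hdat z (Metric.mem_ball_self (by positivity)) t ht).deriv]
  · intro y hy t ht
    rw [norm_div]
    have := hfar y hy t ht
    have h0 := hB t ht
    gcongr
    exact (norm_nonneg _).trans h0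

/-! ### Factorization of `H` -/

/-- An entire function that is not identically zero is a power of `z - c` times an entire function
that does not vanish at `c`. -/
theorem exists_eq_pow_mul_entire {f : ℂ → ℂ} (hf : Differentiable ℂ f) {a : ℂ} (ha : f a ≠ 0)
    (c : ℂ) : ∃ (p : ℕ) (E : ℂ → ℂ), Differentiable ℂ E ∧ E c ≠ 0 ∧
      ∀ z, f z = (z - c) ^ p * E z := by
  have hfin : analyticOrderAt f c ≠ ⊤ := by
    intro h
    rw [analyticOrderAt_eq_top] at h
    have h1 : AnalyticOnNhd ℂ f Set.univ := fun z _ => hf.analyticAt z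
    exact ha (h1.eqOn_zero_of_preconnected_of_eventuallyEq_zero isPreconnected_univ
      (Set.mem_univ c) h (Set.mem_univ a))
  obtain ⟨g, hg, hg0, hgf⟩ := (hf.analyticAt c).analyticOrderAt_ne_top.1 hfin
  set p := analyticOrderNatAt f c
  have hE : ∀ᶠ z in 𝓝 c, Function.update (fun z => f z / (z - c) ^ p) c (g c) z = g z := by
    filter_upwards [hgf] with z hz
    rcases eq_or_ne z c with rfl | h
    · simp
    · rw [Function.update_of_ne h, hz, smul_eq_mul,
        mul_div_cancel_left₀ _ (pow_ne_zero _ (sub_ne_zero.2 h))]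
  refine ⟨p, Function.update (fun z => f z / (z - c) ^ p) c (g c), fun z => ?_, by simpa, ?_⟩
  · rcases eq_or_ne z c with rfl | h
    · exact hg.differentiableAt.congr_of_eventuallyEq hE
    · have h1 : DifferentiableAt ℂ (fun z => f z / (z - c) ^ p) z :=
        (hf z).div (by fun_prop) (pow_ne_zero _ (sub_ne_zero.2 h))
      refine h1.congr_of_eventuallyEq ?_
      filter_upwards [isOpen_ne.mem_nhds h] with y hy
      exact Function.update_of_ne hy _ _
  · intro z
    rcases eq_or_ne z c with rfl | h
    · have := hgf.self_of_nhds
      simpa using this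
    · rw [Function.update_of_ne h, mul_div_cancel₀ _ (pow_ne_zero _ (sub_ne_zero.2 h))]

/-- An entire function whose zeros lie in `{0, 1}` factors as `z ^ p (z - 1) ^ s E` with `E` entire
and without zeros. -/
theorem exists_eq_pow_mul_pow_mul_entire {H : ℂ → ℂ} (hH : Differentiable ℂ H)
    (hH0 : ∀ z, z ≠ 0 → z ≠ 1 → H z ≠ 0) :
    ∃ (p s : ℕ) (E : ℂ → ℂ), Differentiable ℂ E ∧ (∀ z, E z ≠ 0) ∧
      ∀ z, H z = z ^ p * ((z - 1) ^ s * E z) := by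
  -- The point 2 shows that `H` is not identically zero; `H₁ 0 ≠ 0` then plays that role for the
  -- factorization at 1.
  obtain ⟨p, H₁, hH₁, h0, hp⟩ := exists_eq_pow_mul_entire hH (hH0 2 (by norm_num) (by norm_num)) 0
  obtain ⟨s, E, hE, h1, hs⟩ := exists_eq_pow_mul_entire hH₁ h0 1
  have hfac : ∀ z, H z = z ^ p * ((z - 1) ^ s * E z) := fun z => by rw [hp, hs, sub_zero]
  refine ⟨p, s, E, hE, fun z hz => ?_, hfac⟩
  rcases eq_or_ne z 0 with rfl | hz0
  · exact h0 (by rw [hs, hz, mul_zero])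
  rcases eq_or_ne z 1 with rfl | hz1
  · exact h1 hz
  · exact hH0 z hz0 hz1 (by rw [hfac, hz]; ring)

/-! ### The weight on the unit circle: branch cuts and integrability -/

theorem re_lt_one_of_norm_eq_one {z : ℂ} (hz : ‖z‖ = 1) (h1 : z ≠ 1) : z.re < 1 := by
  refine lt_of_le_of_ne (hz ▸ Complex.re_le_norm z) fun h => h1 ?_
  have h2 := Complex.sq_norm_sub_sq_re z
  rw [hz, h] at h2
  have h3 : z.im = 0 := by nlinarith
  exact Complex.ext h h3

theorem one_sub_mem_slitPlane {z : ℂ} (hz : ‖z‖ = 1) (h1 : z ≠ 1) : 1 - z ∈ slitPlane := by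
  left
  have := re_lt_one_of_norm_eq_one hz h1
  simpa using this

theorem neg_mem_slitPlane {z : ℂ} (hz : ‖z‖ = 1) (h1 : z ≠ 1) : -z ∈ slitPlane := by
  rw [mem_slitPlane_iff]
  by_contra! h
  obtain ⟨h2, h3⟩ := h
  have h2 : 0 ≤ z.re := by simpa using h2
  have h3 : z.im = 0 := by simpa using h3
  have h4 := Complex.sq_norm_sub_sq_re z
  rw [hz, h3] at h4
  have := re_lt_one_of_norm_eq_one hz h1
  nlinarith

theorem add_conj_re (b : ℂ) : (b + conj b).re = 2 * b.re := by
  simp; ring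

theorem add_conj_im (b : ℂ) : (b + conj b).im = 0 := by
  simp

theorem norm_one_sub_circleMap (θ : ℝ) : ‖1 - circleMap 0 1 θ‖ = ‖2 * Real.sin (θ / 2)‖ := by
  rw [norm_sub_rev, ← Complex.norm_exp_I_mul_ofReal_sub_one]
  simp [circleMap, mul_comm]

/-- Since `|1 - e^{iθ}| = 2 sin(θ/2)`, Jordan's inequality compares the power with powers of `θ` and
`2π - θ` at the two ends of the interval, which are integrable for exponents above `-1`. -/
theorem intervalIntegrable_one_sub_circleMap_cpow {s : ℂ} (hre : -1 < s.re) (him : s.im = 0) :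
    IntervalIntegrable (fun θ : ℝ => (1 - circleMap 0 1 θ) ^ s) MeasureTheory.volume 0
      (2 * Real.pi) := by
  have hpi := Real.pi_pos
  have i1 : IntervalIntegrable (fun θ : ℝ => θ ^ s.re) MeasureTheory.volume 0 (2 * Real.pi) :=
    intervalIntegral.intervalIntegrable_rpow' hre
  have i2 : IntervalIntegrable (fun θ : ℝ => (2 * Real.pi - θ) ^ s.re) MeasureTheory.volume 0
      (2 * Real.pi) := by
    simpa using (i1.comp_sub_left (2 * Real.pi)).symm
  -- One majorant for all cases: the constant serves nonnegative exponents, the other two terms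
  -- serve negative exponents on the left and right halves.
  have i3 : IntervalIntegrable (fun θ : ℝ => (2 : ℝ) ^ s.re + (2 / Real.pi) ^ s.re * θ ^ s.re
      + (2 / Real.pi) ^ s.re * (2 * Real.pi - θ) ^ s.re) MeasureTheory.volume 0 (2 * Real.pi) :=
    (intervalIntegrable_const.add (i1.const_mul _)).add (i2.const_mul _)
  have hmeas : Measurable fun θ : ℝ => (1 - circleMap 0 1 θ) ^ s := by fun_prop
  refine i3.mono_fun' hmeas.aestronglyMeasurable ?_
  rw [Filter.EventuallyLE, MeasureTheory.ae_restrict_iff' measurableSet_uIoc]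
  have hne : ∀ᵐ θ : ℝ, θ ≠ 2 * Real.pi := by
    simp [MeasureTheory.ae_iff]
  filter_upwards [hne] with θ hθne hθ
  rw [Set.uIoc_of_le (by positivity)] at hθ
  obtain ⟨h0, h1⟩ := hθ
  have h2 : θ < 2 * Real.pi := lt_of_le_of_ne h1 hθne
  have hsin : 0 < Real.sin (θ / 2) := Real.sin_pos_of_pos_of_lt_pi (by linarith) (by linarith)
  have hnorm : ‖1 - circleMap 0 1 θ‖ = 2 * Real.sin (θ / 2) := by
    rw [norm_one_sub_circleMap, Real.norm_of_nonneg (by positivity)]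
  have hle : ‖(1 - circleMap 0 1 θ) ^ s‖ ≤ (2 * Real.sin (θ / 2)) ^ s.re := by
    have := Complex.norm_cpow_le (1 - circleMap 0 1 θ) s
    rwa [him, mul_zero, Real.exp_zero, div_one, hnorm] at this
  refine hle.trans ?_
  have p1 : 0 ≤ (2 : ℝ) ^ s.re := by positivity
  have p2 : 0 ≤ (2 / Real.pi) ^ s.re * θ ^ s.re := by positivity
  have p3 : 0 ≤ (2 / Real.pi) ^ s.re * (2 * Real.pi - θ) ^ s.re :=
    mul_nonneg (by positivity) (Real.rpow_nonneg (by linarith) _)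
  rcases le_or_gt 0 s.re with hs | hs
  · have : (2 * Real.sin (θ / 2)) ^ s.re ≤ 2 ^ s.re :=
      Real.rpow_le_rpow (by positivity) (by linarith [Real.sin_le_one (θ / 2)]) hs
    linarith
  · rcases le_or_gt θ Real.pi with hp | hp
    · have h3 := Real.mul_le_sin (x := θ / 2) (by linarith) (by linarith)
      have h4 : (2 * Real.sin (θ / 2)) ^ s.re ≤ (2 / Real.pi * θ) ^ s.re :=
        Real.rpow_le_rpow_of_nonpos (by positivity) (by linarith) hs.le
      rw [Real.mul_rpow (by positivity) h0.le] at h4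
      linarith
    · have h3 := Real.mul_le_sin (x := Real.pi - θ / 2) (by linarith) (by linarith)
      rw [Real.sin_pi_sub] at h3
      have h5 : 0 < 2 / Real.pi * (2 * Real.pi - θ) := mul_pos (by positivity) (by linarith)
      have h4 : (2 * Real.sin (θ / 2)) ^ s.re ≤ (2 / Real.pi * (2 * Real.pi - θ)) ^ s.re :=
        Real.rpow_le_rpow_of_nonpos h5 (by linarith) hs.le
      rw [Real.mul_rpow (x := 2 / Real.pi) (by positivity) (by linarith)] at h4
      linarith

theorem neg_circleMap_cpow {θ : ℝ} (h0 : 0 < θ) (h1 : θ < 2 * Real.pi) (a : ℂ) :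
    (-circleMap 0 1 θ) ^ a = exp ((θ - Real.pi) * I * a) := by
  have h2 : -circleMap 0 1 θ = exp ((θ - Real.pi) * I) := by
    rw [sub_mul, Complex.exp_sub, Complex.exp_pi_mul_I]
    simp [circleMap, div_neg]
  have h3 : ((θ - Real.pi) * I : ℂ).im = θ - Real.pi := by simp
  rw [h2, Complex.cpow_def_of_ne_zero (Complex.exp_ne_zero _), Complex.log_exp]
  · rw [h3]; linarith
  · rw [h3]; linarith

/-- The density of the Cauchy integrals in the second column of `Y_n`. -/
noncomputable def jacobiDensity (b : ℂ) (H : ℂ → ℂ) (n : ℕ) (t : ℂ) : ℂ :=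
  jacobiWeight b H t / t ^ n

theorem circleMap_zero_one_ne_zero (θ : ℝ) : circleMap 0 1 θ ≠ 0 := by
  simp

theorem circleMap_zero_one_ne_one {θ : ℝ} (h0 : 0 < θ) (h1 : θ < 2 * Real.pi) :
    circleMap 0 1 θ ≠ 1 := by
  intro h
  have h2 := norm_one_sub_circleMap θ
  have hsin : 0 < Real.sin (θ / 2) := Real.sin_pos_of_pos_of_lt_pi (by linarith) (by linarith)
  rw [h, sub_self, norm_zero, eq_comm, norm_eq_zero] at h2
  linarith

theorem circleIntegrable_jacobiDensity {b : ℂ} (hb : -1 / 2 < b.re) {H : ℂ → ℂ}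
    (hH : Continuous H) (n : ℕ) : CircleIntegrable (jacobiDensity b H n) 0 1 := by
  have i1 : IntervalIntegrable (fun θ : ℝ => (1 - circleMap 0 1 θ) ^ (b + conj b))
      MeasureTheory.volume 0 (2 * Real.pi) :=
    intervalIntegrable_one_sub_circleMap_cpow (by rw [add_conj_re]; linarith) (add_conj_im b)
  have hc : Continuous fun θ : ℝ => exp ((θ - Real.pi) * I * (-conj b)) * H (circleMap 0 1 θ)
      / circleMap 0 1 θ ^ n := by
    refine Continuous.div (by fun_prop) (by fun_prop) fun θ => ?_
    exact pow_ne_zero _ (circleMap_zero_one_ne_zero θ)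
  refine (i1.continuousOn_mul hc.continuousOn).congr_ae ?_
  rw [Filter.EventuallyEq, MeasureTheory.ae_restrict_iff' measurableSet_uIoc]
  have hne : ∀ᵐ θ : ℝ, θ ≠ 2 * Real.pi := by
    simp [MeasureTheory.ae_iff]
  filter_upwards [hne] with θ hθne hθ
  rw [Set.uIoc_of_le (by positivity)] at hθ
  rw [jacobiDensity, jacobiWeight, neg_circleMap_cpow hθ.1 (lt_of_le_of_ne hθ.2 hθne)]
  ring

/-! ### Pearson equation and integration by parts -/

/-- Pearson's equation `t(1-t) w' = V w`: away from `t = 1` both principal powers are holomorphic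
along the circle, and `G` stands for `q H'/H`. -/
theorem hasDerivAt_jacobiDensity (b : ℂ) {H G : ℂ → ℂ} (hH : Differentiable ℂ H)
    (hG : ∀ z, z * (1 - z) * deriv H z = G z * H z) (n : ℕ) {t : ℂ} (ht : ‖t‖ = 1) (h1 : t ≠ 1) :
    HasDerivAt (jacobiDensity b H n)
      (((-n - conj b) * (1 - t) - (b + conj b) * t + G t) / (t * (1 - t)) *
        jacobiDensity b H n t) t := by
  have ht0 : t ≠ 0 := by rintro rfl; simp at ht
  have ht1 : 1 - t ≠ 0 := sub_ne_zero.2 h1.symm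
  have hn1 : -t ∈ slitPlane := neg_mem_slitPlane ht h1
  have hn2 : 1 - t ∈ slitPlane := one_sub_mem_slitPlane ht h1
  have d1 := (hasDerivAt_neg t).cpow_const (c := -conj b) hn1
  have d2 := ((hasDerivAt_id t).const_sub 1).cpow_const (c := b + conj b) hn2
  have d3 := ((d1.mul d2).mul (hH t).hasDerivAt).div (hasDerivAt_pow n t) (pow_ne_zero n ht0)
  refine d3.congr_deriv ?_
  have e1 : (-t) ^ (-conj b - 1) = (-t) ^ (-conj b) / (-t) := by
    rw [Complex.cpow_sub _ _ (neg_ne_zero.2 ht0), Complex.cpow_one]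
  have e2 : (1 - t) ^ (b + conj b - 1) = (1 - t) ^ (b + conj b) / (1 - t) := by
    rw [Complex.cpow_sub _ _ ht1, Complex.cpow_one]
  have e3 : deriv H t = G t * H t / (t * (1 - t)) := by
    rw [← hG, mul_div_cancel_left₀ _ (mul_ne_zero ht0 ht1)]
  have e4 : (n : ℂ) * t ^ (n - 1) = n * t ^ n / t := by
    rcases n with _ | n
    · simp
    · rw [Nat.add_sub_cancel, pow_succ]; field_simp
  simp only [id, Pi.mul_apply]
  rw [e1, e2, e3, e4, jacobiDensity, jacobiWeight]
  field_simp
  ring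

/-- Integration by parts for the density, whose product with `t (1 - t)` vanishes at the
endpoint `t = 1`. -/
theorem integral_by_parts_jacobiDensity {b : ℂ} (hb : -1 / 2 < b.re) {H G : ℂ → ℂ}
    (hH : Differentiable ℂ H) (hGc : Continuous G)
    (hG : ∀ z, z * (1 - z) * deriv H z = G z * H z) (n : ℕ) {f : ℂ → ℂ}
    (hf : ∀ t ∈ Metric.sphere (0 : ℂ) 1, AnalyticAt ℂ f t) :
    (∮ t in C(0, 1), ((1 - 2 * t) * f t + t * (1 - t) * deriv f t +
      ((-n - conj b) * (1 - t) - (b + conj b) * t + G t) * f t) * jacobiDensity b H n t) = 0 := by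
  have hsph : ∀ θ : ℝ, circleMap 0 1 θ ∈ Metric.sphere (0 : ℂ) 1 :=
    fun θ => circleMap_mem_sphere 0 zero_le_one θ
  have hfc : ContinuousOn f (Metric.sphere 0 1) := fun t ht =>
    (hf t ht).continuousAt.continuousWithinAt
  have hfd : ContinuousOn (deriv f) (Metric.sphere 0 1) := fun t ht =>
    (hf t ht).deriv.continuousAt.continuousWithinAt
  have hw := circleIntegrable_jacobiDensity hb hH.continuous n
  set φ : ℂ → ℂ := fun t => t * (1 - t) * f t * jacobiDensity b H n t with hφ
  have hone : circleMap 0 1 0 = 1 := by simp [circleMap]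
  have htwo : circleMap 0 1 (2 * Real.pi) = 1 := by simp [circleMap]
  have hcont : ContinuousOn (fun θ => φ (circleMap 0 1 θ)) (Set.Icc 0 (2 * Real.pi)) := by
    -- The factor `1 - t` raises the exponent to `1 + 2 Re b`, which is positive exactly when `Re b
    -- > -1/2`; this makes the product continuous, with value 0 at both endpoints.
    have hs : 0 < (1 + (b + conj b)).re := by
      rw [Complex.add_re, add_conj_re, Complex.one_re]; linarith
    have hpow : Continuous fun θ : ℝ => (1 - circleMap 0 1 θ) ^ (1 + (b + conj b)) := by
      refine continuous_iff_continuousAt.2 fun θ => ?_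
      have hg : ContinuousAt (fun θ : ℝ => (1 - circleMap 0 1 θ, 1 + (b + conj b))) θ := by
        fun_prop
      have hp : ContinuousAt (fun x : ℂ × ℂ => x.1 ^ x.2)
          (1 - circleMap 0 1 θ, 1 + (b + conj b)) := by
        rcases eq_or_ne (circleMap 0 1 θ) 1 with h | h
        · rw [h, sub_self]
          exact continuousAt_cpow_zero_of_re_pos hs
        · exact continuousAt_cpow (one_sub_mem_slitPlane (by simp) h)
      exact ContinuousAt.comp (f := fun θ : ℝ => (1 - circleMap 0 1 θ, 1 + (b + conj b))) hp hg
    have hfγ : Continuous fun θ : ℝ => f (circleMap 0 1 θ) :=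
      hfc.comp_continuous (continuous_circleMap 0 1) hsph
    have hc : Continuous fun θ : ℝ => exp ((θ - Real.pi) * I * (-conj b)) *
        (1 - circleMap 0 1 θ) ^ (1 + (b + conj b)) * circleMap 0 1 θ * f (circleMap 0 1 θ) *
        H (circleMap 0 1 θ) / circleMap 0 1 θ ^ n := by
      have := hH.continuous
      refine Continuous.div (((((by fun_prop : Continuous fun θ : ℝ =>
        exp ((θ - Real.pi) * I * (-conj b))).mul hpow).mul (continuous_circleMap 0 1)).mul hfγ).mul
        (this.comp (continuous_circleMap 0 1))) (by fun_prop) fun θ => ?_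
      exact pow_ne_zero _ (circleMap_zero_one_ne_zero θ)
    refine hc.continuousOn.congr fun θ hθ => ?_
    have hs0 : 1 + (b + conj b) ≠ 0 := fun h => by simp [h] at hs
    rcases eq_or_lt_of_le hθ.1 with h0 | h0
    · subst h0
      simp [hφ, hone, Complex.zero_cpow hs0]
    rcases eq_or_lt_of_le hθ.2 with h1 | h1
    · subst h1
      simp [hφ, htwo, Complex.zero_cpow hs0]
    · have h2 : 1 - circleMap 0 1 θ ≠ 0 := sub_ne_zero.2 (circleMap_zero_one_ne_one h0 h1).symm
      simp only [hφ]
      rw [jacobiDensity, jacobiWeight, neg_circleMap_cpow h0 h1, Complex.cpow_add 1 (b + conj b) h2,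
        Complex.cpow_one]
      ring
  have hderiv : ∀ θ ∈ Set.Ioo 0 (2 * Real.pi), HasDerivAt (fun θ => φ (circleMap 0 1 θ))
      (deriv (circleMap 0 1) θ • (((1 - 2 * circleMap 0 1 θ) * f (circleMap 0 1 θ) +
        circleMap 0 1 θ * (1 - circleMap 0 1 θ) * deriv f (circleMap 0 1 θ) +
        ((-n - conj b) * (1 - circleMap 0 1 θ) - (b + conj b) * circleMap 0 1 θ +
          G (circleMap 0 1 θ)) * f (circleMap 0 1 θ)) *
        jacobiDensity b H n (circleMap 0 1 θ))) θ := by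
    intro θ hθ
    have hne := circleMap_zero_one_ne_one hθ.1 hθ.2
    have hne' : 1 - circleMap 0 1 θ ≠ 0 := sub_ne_zero.2 hne.symm
    have hne0 := circleMap_zero_one_ne_zero θ
    set t := circleMap 0 1 θ with htdef
    have dw := hasDerivAt_jacobiDensity b hH hG n (t := t) (by simp [htdef]) hne
    have df := (hf t (hsph θ)).differentiableAt.hasDerivAt
    have dq := (hasDerivAt_id t).mul ((hasDerivAt_id t).const_sub 1)
    have dφ := ((dq.mul df).mul dw)
    rw [deriv_circleMap]
    refine (HasDerivAt.scomp θ (dφ.congr_deriv ?_) (hasDerivAt_circleMap 0 1 θ))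
    simp only [id, Pi.mul_apply]
    field_simp
    ring
  have hci : CircleIntegrable (fun t => ((1 - 2 * t) * f t + t * (1 - t) * deriv f t +
      ((-n - conj b) * (1 - t) - (b + conj b) * t + G t) * f t) * jacobiDensity b H n t) 0 1 :=
    circleIntegrable_continuousOn_mul hw (by fun_prop)
  have hint := intervalIntegral.integral_eq_sub_of_hasDerivAt_of_le (by positivity) hcont hderiv
    hci.out
  rw [circleIntegral, hint]
  simp [hφ, hone, htwo]

/-! ### Entire bilinear expressions in Cauchy transforms -/

section Pearson

variable {w V : ℂ → ℂ}

/-- Integration by parts is applied to `f(t)/(t-z)`. Replacing `q(t)` by `q(z)` in front of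
`(t-z)⁻²` leaves no further pole because `q` is quadratic; together with the term `1 - 2t` it leaves
only the moment of `f`. -/
theorem pearson_cauchyTransform (hw : CircleIntegrable w 0 1) (hV : Continuous V)
    (hparts : ∀ f : ℂ → ℂ, (∀ t ∈ Metric.sphere (0 : ℂ) 1, AnalyticAt ℂ f t) →
      (∮ t in C(0, 1), ((1 - 2 * t) * f t + t * (1 - t) * deriv f t + V t * f t) * w t) = 0)
    {f : ℂ → ℂ} (hf : Differentiable ℂ f) {z : ℂ} (hz : ‖z‖ ≠ 1) :
    z * (1 - z) * deriv (cauchyTransform w f) z =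
      cauchyTransform w (fun t => t * (1 - t) * deriv f t + V t * f t) z -
        ∮ t in C(0, 1), f t * w t := by
  have hs : ∀ t ∈ Metric.sphere (0 : ℂ) 1, t - z ≠ 0 := fun t ht =>
    sub_ne_zero_of_mem_sphere ht hz
  have hfc := hf.continuous
  have hfd := hf.deriv.continuous
  have hd : ∀ t ∈ Metric.sphere (0 : ℂ) 1, deriv (fun t => f t / (t - z)) t =
      deriv f t / (t - z) - f t / (t - z) ^ 2 := by
    intro t ht
    have h1 := (hf t).hasDerivAt.div ((hasDerivAt_id t).sub_const z) (hs t ht)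
    refine h1.deriv.trans ?_
    have := hs t ht
    simp only [id]
    field_simp
  have hibp := hparts (fun t => f t / (t - z)) fun t ht =>
    (hf.analyticAt t).div (analyticAt_id.sub analyticAt_const) (hs t ht)
  have i1 : CircleIntegrable (fun t => (t * (1 - t) * deriv f t + V t * f t) / (t - z) * w t) 0 1 :=
    circleIntegrable_continuousOn_mul hw (ContinuousOn.div (by fun_prop) (by fun_prop) hs)
  have i2 : CircleIntegrable (fun t => f t * w t) 0 1 :=
    circleIntegrable_continuousOn_mul hw (by fun_prop)
  have hibp' : (∮ t in C(0, 1), ((1 - 2 * t) * (f t / (t - z)) + t * (1 - t) *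
      (deriv f t / (t - z) - f t / (t - z) ^ 2) + V t * (f t / (t - z))) * w t) = 0 := by
    refine Eq.trans (circleIntegral.integral_congr zero_le_one fun t ht => ?_) hibp
    simp only [hd t ht]
  have i12 : CircleIntegrable (fun t => (t * (1 - t) * deriv f t + V t * f t) / (t - z) * w t -
      f t * w t) 0 1 := i1.sub i2
  rw [(hasDerivAt_cauchyTransform hw hfc hz).deriv, ← circleIntegral.integral_const_mul,
    cauchyTransform, ← circleIntegral.integral_sub i1 i2, ← sub_eq_zero,
    ← circleIntegral.integral_sub ?_ i12]
  · refine Eq.trans (Eq.trans (circleIntegral.integral_congr zero_le_one fun t ht => ?_)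
      (circleIntegral.integral_const_mul (-1) _ _ _)) (by rw [hibp', mul_zero])
    have := hs t ht
    field_simp
    ring
  · refine circleIntegrable_continuousOn_mul hw (g := fun t => f t / (t - z) ^ 2)
      (ContinuousOn.div (by fun_prop) (by fun_prop) fun t ht => pow_ne_zero 2 (hs t ht))
      |>.const_fun_smul (a := z * (1 - z))

/-- The entire continuation of the bilinear expression
`q f' F_g - q F_f' g + (V / 2) (f F_g + F_f g)` in functions and their Cauchy transforms `F`,
where `q = z (1 - z)`. -/
noncomputable def pearsonBilin (w V f g : ℂ → ℂ) (z : ℂ) : ℂ :=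
  z * (1 - z) * deriv f z * slopeTransform w g z
    - g z * slopeTransform w (fun t => t * (1 - t) * deriv f t + V t * f t) z
    + g z * (∮ t in C(0, 1), f t * w t)
    + V z / 2 * (f z * slopeTransform w g z + g z * slopeTransform w f z)

theorem differentiable_pearsonBilin (hw : CircleIntegrable w 0 1) (hV : Differentiable ℂ V)
    {f g : ℂ → ℂ} (hf : Differentiable ℂ f) (hg : Differentiable ℂ g) :
    Differentiable ℂ (pearsonBilin w V f g) := by
  have h1 := hf.deriv
  have h2 := differentiable_slopeTransform hw hf
  have h3 := differentiable_slopeTransform hw hg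
  have h4 := differentiable_slopeTransform hw
    (f := fun t => t * (1 - t) * deriv f t + V t * f t) (by fun_prop)
  unfold pearsonBilin
  fun_prop

/-- After each transform is split, the terms in `cauchyTransform w 1` have coefficient `q f' g - g
(q f' + V f) + V f g = 0`. -/
theorem pearsonBilin_eq (hw : CircleIntegrable w 0 1) (hV : Continuous V)
    (hparts : ∀ f : ℂ → ℂ, (∀ t ∈ Metric.sphere (0 : ℂ) 1, AnalyticAt ℂ f t) →
      (∮ t in C(0, 1), ((1 - 2 * t) * f t + t * (1 - t) * deriv f t + V t * f t) * w t) = 0)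
    {f g : ℂ → ℂ} (hf : Differentiable ℂ f) (hg : Differentiable ℂ g) {z : ℂ} (hz : ‖z‖ ≠ 1) :
    pearsonBilin w V f g z = z * (1 - z) * (deriv f z * cauchyTransform w g z
      - deriv (cauchyTransform w f) z * g z)
      + V z / 2 * (f z * cauchyTransform w g z + cauchyTransform w f z * g z) := by
  have hfc := hf.continuous
  have hfd := hf.deriv.continuous
  have h1 := pearson_cauchyTransform hw hV hparts hf hz
  have h2 := cauchyTransform_eq hw hfc hz
  have h3 := cauchyTransform_eq hw hg.continuous hz
  have h4 := cauchyTransform_eq hw (f := fun t => t * (1 - t) * deriv f t + V t * f t)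
    (by fun_prop) hz
  rw [h4] at h1
  rw [pearsonBilin, h2, h3]
  linear_combination g z * h1

end Pearson

/-! ### Biorthogonality and the determinant of `Y_n` -/

section Orthogonality

/-- The linear functional `Q ↦ ∮ Q(σ(t)) u(t) dt` on polynomials. -/
noncomputable def circlePairing {u σ : ℂ → ℂ} (hu : CircleIntegrable u 0 1)
    (hσ : ContinuousOn σ (Metric.sphere 0 1)) : ℂ[X] →ₗ[ℂ] ℂ where
  toFun Q := ∮ t in C(0, 1), Q.eval (σ t) * u t
  map_add' P Q := by
    have h : ∀ Q : ℂ[X], CircleIntegrable (fun t => Q.eval (σ t) * u t) 0 1 := fun Q =>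
      circleIntegrable_continuousOn_mul hu (Q.continuous.comp_continuousOn hσ)
    simp only [eval_add, add_mul]
    exact circleIntegral.integral_add (h P) (h Q)
  map_smul' a Q := by
    simp only [eval_smul, smul_eq_mul, RingHom.id_apply, mul_assoc]
    exact circleIntegral.integral_const_mul _ _ _ _

theorem circlePairing_apply {u σ : ℂ → ℂ} (hu : CircleIntegrable u 0 1)
    (hσ : ContinuousOn σ (Metric.sphere 0 1)) (Q : ℂ[X]) :
    circlePairing hu hσ Q = ∮ t in C(0, 1), Q.eval (σ t) * u t := rfl

theorem linearMap_eq_zero_of_degree_lt (L : ℂ[X] →ₗ[ℂ] ℂ) {B : ℕ → ℂ[X]}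
    (hm : ∀ k, (B k).Monic) (hd : ∀ k, (B k).natDegree = k) {n : ℕ} (hL : ∀ k < n, L (B k) = 0)
    {Q : ℂ[X]} (hQ : Q.degree < n) : L Q = 0 := by
  induction n generalizing Q with
  | zero =>
    have : Q = 0 := by simpa [Nat.WithBot.lt_zero_iff] using hQ
    rw [this, map_zero]
  | succ n ih =>
    have h1 : (Q - Polynomial.C (Q.coeff n) * B n).degree < n := by
      rw [degree_lt_iff_coeff_zero]
      intro m hmn
      rw [coeff_sub, coeff_C_mul]
      rcases eq_or_lt_of_le hmn with rfl | hlt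
      · have : (B n).coeff n = 1 := by
          have := (hm n).coeff_natDegree
          rwa [hd] at this
        rw [this, mul_one, sub_self]
      · have : (B n).coeff m = 0 := coeff_eq_zero_of_natDegree_lt (by rwa [hd])
        rw [this, (degree_lt_iff_coeff_zero _ _).1 hQ m hlt, mul_zero, sub_zero]
    have h2 := ih (fun k hk => hL k (hk.trans n.lt_succ_self)) h1
    rw [map_sub, ← smul_eq_C_mul, map_smul, hL n n.lt_succ_self, smul_zero, sub_zero] at h2
    exact h2

/-- Two monic polynomials of the same degree differ by a polynomial of lower degree, which the
functional annihilates. -/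
theorem linearMap_eq_of_monic (L : ℂ[X] →ₗ[ℂ] ℂ) {B : ℕ → ℂ[X]}
    (hm : ∀ k, (B k).Monic) (hd : ∀ k, (B k).natDegree = k) {n : ℕ} (hL : ∀ k < n, L (B k) = 0)
    {Q : ℂ[X]} (hQm : Q.Monic) (hQ : Q.natDegree = n) : L Q = L (B n) := by
  rw [← sub_eq_zero, ← map_sub]
  refine linearMap_eq_zero_of_degree_lt L hm hd hL ?_
  have hdeg : Q.degree = n := by rw [degree_eq_natDegree hQm.ne_zero, hQ]
  refine (degree_sub_lt_left ?_ hQm.ne_zero ?_).trans_eq hdeg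
  · rw [hdeg, degree_eq_natDegree (hm n).ne_zero, hd]
  · rw [hQm.leadingCoeff, (hm n).leadingCoeff]

theorem conj_eval_eq_eval_inv (P : ℂ[X]) {t : ℂ} (ht : ‖t‖ = 1) :
    conj (P.eval t) = (P.map (starRingEnd ℂ)).eval t⁻¹ := by
  have h : t⁻¹ = conj t := by
    rw [Complex.inv_def, Complex.normSq_eq_norm_sq, ht]; simp
  rw [h, eval_map, eval₂_at_apply]

theorem eval_reflect_inv_mul_pow (P : ℂ[X]) {t : ℂ} (ht : t ≠ 0) {N : ℕ} (hP : P.natDegree ≤ N) :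
    (P.reflect N).eval t⁻¹ * t ^ N = P.eval t := by
  let _ := invertibleOfNonzero ht
  have := eval₂_reflect_mul_pow (RingHom.id ℂ) t N P hP
  simpa using this

theorem reflect_reflect (P : ℂ[X]) (N : ℕ) : (P.reflect N).reflect N = P := by
  ext k
  simp

theorem recip_eval {P : ℂ[X]} {k : ℕ} (hP : P.natDegree = k) {t : ℂ} (ht : ‖t‖ = 1) :
    (recip k P).eval t = conj (P.eval t) * t ^ k := by
  have ht0 : t ≠ 0 := by rintro rfl; simp at ht
  have hle : (recip k P).natDegree ≤ k := by
    refine natDegree_reflect_le.trans (max_le le_rfl ?_)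
    exact natDegree_map_le.trans hP.le
  rw [← eval_reflect_inv_mul_pow _ ht0 hle, recip, reflect_reflect, conj_eval_eq_eval_inv P ht]

variable {ν : ℂ → ℂ} {Φ Ψ : ℕ → ℂ[X]} {h : ℕ → ℂ}

theorem circleIntegrable_mul_div_I_mul (hν : CircleIntegrable ν 0 1) {g : ℂ → ℂ}
    (hg : ContinuousOn g (Metric.sphere 0 1)) :
    CircleIntegrable (fun t => g t * (ν t / (I * t))) 0 1 := by
  have h1 : CircleIntegrable (fun t => (g t / (I * t)) * ν t) 0 1 := by
    refine circleIntegrable_continuousOn_mul hν (hg.div (by fun_prop) fun t ht => ?_)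
    exact mul_ne_zero I_ne_zero (by rintro rfl; simp at ht)
  refine h1.congr_codiscreteWithin ?_
  exact Eventually.of_forall fun t => by ring

theorem continuousOn_inv_sphere : ContinuousOn (fun t : ℂ => t⁻¹) (Metric.sphere 0 1) :=
  continuousOn_inv₀.mono fun t ht => by rintro rfl; simp at ht

/-- On the circle `conj (Ψ_k t)` is a polynomial in `t⁻¹`, and so is `Q(t)/t^m`. Working in the
variable `t⁻¹` makes the pairing linear, and the conjugated `Ψ_k` with `k ≤ m` span all polynomials
of degree at most `m`. -/
theorem IsBiorthogonal.integral_left_eq_zero (hΦ : IsBiorthogonal ν Φ Ψ h)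
    (hν : CircleIntegrable ν 0 1) (m : ℕ) {Q : ℂ[X]} (hQ : Q.natDegree ≤ m) :
    (∮ t in C(0, 1), (Φ (m + 1)).eval t * Q.eval t * (ν t / t ^ (m + 1))) = 0 := by
  have hu := circleIntegrable_mul_div_I_mul hν (g := fun t => (Φ (m + 1)).eval t) (by fun_prop)
  have hB : ∀ k < m + 1, circlePairing hu continuousOn_inv_sphere
      ((Ψ k).map (starRingEnd ℂ)) = 0 := by
    intro k hk
    have := hΦ.orthogonal (m + 1) k
    rw [if_neg hk.ne'] at this
    rw [circlePairing_apply]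
    refine Eq.trans (circleIntegral.integral_congr zero_le_one fun t ht => ?_) this
    rw [conj_eval_eq_eval_inv _ (by simpa using ht)]
    ring
  have hz := linearMap_eq_zero_of_degree_lt (circlePairing hu continuousOn_inv_sphere)
    (fun k => (hΦ.monic_right k).map _)
    (fun k => (natDegree_map_eq_of_injective (starRingEnd ℂ).injective _).trans
      (hΦ.degree_right k)) hB (Q := Q.reflect m) (by
        refine (degree_le_natDegree).trans_lt ?_
        exact_mod_cast Nat.lt_succ_of_le (natDegree_reflect_le.trans (max_le le_rfl hQ)))
  have h2 : (∮ t in C(0, 1), (Φ (m + 1)).eval t * Q.eval t * (ν t / t ^ (m + 1)))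
      = I * circlePairing hu continuousOn_inv_sphere (Q.reflect m) := by
    rw [circlePairing_apply, ← circleIntegral.integral_const_mul]
    refine circleIntegral.integral_congr zero_le_one fun t ht => ?_
    have ht0 : t ≠ 0 := by rintro rfl; simp at ht
    rw [← eval_reflect_inv_mul_pow Q ht0 hQ]
    field_simp
    ring
  rw [h2, hz, mul_zero]

/-- On the circle `Ψ_m^*(t) = t^m conj (Ψ_m t)`, so the power `t^m` cancels and only the leading
term `Φ_m` of `Q` pairs nontrivially with `Ψ_m`. -/
theorem IsBiorthogonal.integral_recip_eq (hΦ : IsBiorthogonal ν Φ Ψ h)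
    (hν : CircleIntegrable ν 0 1) (m : ℕ) {Q : ℂ[X]} (hQm : Q.Monic) (hQ : Q.natDegree = m) :
    (∮ t in C(0, 1), (recip m (Ψ m)).eval t * Q.eval t * (ν t / t ^ (m + 1))) = I * h m := by
  have hu := circleIntegrable_mul_div_I_mul hν (g := fun t => conj ((Ψ m).eval t))
    (by have := Complex.continuous_conj; fun_prop)
  have hB : ∀ k, circlePairing hu (σ := fun t => t) continuousOn_id (Φ k)
      = if k = m then h k else 0 := by
    intro k
    rw [← hΦ.orthogonal k m, circlePairing_apply]
    refine circleIntegral.integral_congr zero_le_one fun t ht => ?_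
    ring
  have hz := linearMap_eq_of_monic (circlePairing hu (σ := fun t => t) continuousOn_id)
    hΦ.monic_left hΦ.degree_left (fun k hk => by rw [hB, if_neg hk.ne]) hQm hQ
  rw [hB, if_pos rfl] at hz
  rw [← hz, circlePairing_apply, ← circleIntegral.integral_const_mul]
  refine circleIntegral.integral_congr zero_le_one fun t ht => ?_
  have ht0 : t ≠ 0 := by rintro rfl; simp at ht
  rw [recip_eval (hΦ.degree_right m) (by simpa using ht)]
  field_simp
  ring

/-- This is `det Y_n` up to normalization, computed without Liouville's theorem: with `P₁, R₁` the
quotients by `t - z`, the combined kernel `(P(z)R(t) - R(z)P(t))/(t-z)` equals `P(t)R₁(t) -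
R(t)P₁(t)`. The first term integrates to 0 by degree, and the second is evaluated because `P₁` is
monic of degree `m`. -/
theorem IsBiorthogonal.wronskian (hΦ : IsBiorthogonal ν Φ Ψ h) (hν : CircleIntegrable ν 0 1)
    (m : ℕ) (hw : CircleIntegrable (fun t => ν t / t ^ (m + 1)) 0 1) {z : ℂ} (hz : ‖z‖ ≠ 1) :
    (Φ (m + 1)).eval z * cauchyTransform (fun t => ν t / t ^ (m + 1))
        (fun t => (recip m (Ψ m)).eval t) z
      - (recip m (Ψ m)).eval z * cauchyTransform (fun t => ν t / t ^ (m + 1))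
        (fun t => (Φ (m + 1)).eval t) z = -(I * h m) := by
  have hs : ∀ t ∈ Metric.sphere (0 : ℂ) 1, t - z ≠ 0 := fun t ht =>
    sub_ne_zero_of_mem_sphere ht hz
  set P := Φ (m + 1) with hP
  set R := recip m (Ψ m) with hR
  set w : ℂ → ℂ := fun t => ν t / t ^ (m + 1)
  have hdiv : ∀ (A : ℂ[X]) (t : ℂ), A.eval t - A.eval z = (t - z) *
      (A /ₘ (Polynomial.X - Polynomial.C z)).eval t := by
    intro A t
    have := congrArg (eval t) (modByMonic_add_div A (Polynomial.X - Polynomial.C z))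
    rw [modByMonic_X_sub_C_eq_C_eval] at this
    simp only [eval_add, eval_C, eval_mul, eval_sub, eval_X] at this
    linear_combination -this
  have hdeg : ∀ A : ℂ[X], (A /ₘ (Polynomial.X - Polynomial.C z)).natDegree = A.natDegree - 1 := by
    intro A
    rw [natDegree_divByMonic _ (monic_X_sub_C z), natDegree_X_sub_C]
  have hRdeg : R.natDegree ≤ m :=
    natDegree_reflect_le.trans (max_le le_rfl (natDegree_map_le.trans (hΦ.degree_right m).le))
  have hPdeg : P.natDegree = m + 1 := hΦ.degree_left (m + 1)
  have hQm : (P /ₘ (Polynomial.X - Polynomial.C z)).Monic := by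
    rw [Monic, leadingCoeff_divByMonic_of_monic (monic_X_sub_C z), (hΦ.monic_left _).leadingCoeff]
    rw [degree_X_sub_C, degree_eq_natDegree (hΦ.monic_left _).ne_zero, hPdeg]
    exact_mod_cast Nat.succ_le_succ (Nat.zero_le m)
  have k1 := hΦ.integral_left_eq_zero hν m (Q := R /ₘ (Polynomial.X - Polynomial.C z))
    (by rw [hdeg]; omega)
  have k2 := hΦ.integral_recip_eq hν m hQm (by rw [hdeg, hPdeg]; omega)
  have i1 : CircleIntegrable (fun t => R.eval t / (t - z) * w t) 0 1 :=
    circleIntegrable_continuousOn_mul hw (ContinuousOn.div (by fun_prop) (by fun_prop) hs)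
  have i2 : CircleIntegrable (fun t => P.eval t / (t - z) * w t) 0 1 :=
    circleIntegrable_continuousOn_mul hw (ContinuousOn.div (by fun_prop) (by fun_prop) hs)
  have i1' : CircleIntegrable (fun t => P.eval z * (R.eval t / (t - z) * w t)) 0 1 :=
    i1.const_fun_smul (a := P.eval z)
  have i2' : CircleIntegrable (fun t => R.eval z * (P.eval t / (t - z) * w t)) 0 1 :=
    i2.const_fun_smul (a := R.eval z)
  have i3 : CircleIntegrable (fun t => P.eval t *
      (R /ₘ (Polynomial.X - Polynomial.C z)).eval t * w t) 0 1 :=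
    circleIntegrable_continuousOn_mul hw (by fun_prop)
  have i4 : CircleIntegrable (fun t => R.eval t *
      (P /ₘ (Polynomial.X - Polynomial.C z)).eval t * w t) 0 1 :=
    circleIntegrable_continuousOn_mul hw (by fun_prop)
  rw [cauchyTransform, cauchyTransform, ← circleIntegral.integral_const_mul,
    ← circleIntegral.integral_const_mul, ← circleIntegral.integral_sub i1' i2']
  refine Eq.trans (Eq.trans ?_ (circleIntegral.integral_sub i3 i4))
    (by rw [k1, k2, zero_sub])
  refine circleIntegral.integral_congr zero_le_one fun t ht => ?_
  have h0 := hs t ht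
  have e1 := hdiv P t
  have e2 := hdiv R t
  rw [← mul_right_inj' h0]
  field_simp
  linear_combination (w t) * (P.eval t * e2 - R.eval t * e1)

end Orthogonality

/-! ### Local branches of `C_n` -/

theorem exists_analyticAt_log {g : ℂ → ℂ} {z₀ : ℂ} (hg : AnalyticAt ℂ g z₀) (h0 : g z₀ ≠ 0) :
    ∃ L : ℂ → ℂ, AnalyticAt ℂ L z₀ ∧ ∀ᶠ z in 𝓝 z₀, exp (L z) = g z := by
  refine ⟨fun z => log (g z / g z₀) + log (g z₀), ?_, ?_⟩
  · refine AnalyticAt.add (AnalyticAt.clog (hg.div analyticAt_const h0) ?_) analyticAt_const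
    rw [div_self h0]
    exact one_mem_slitPlane
  · filter_upwards [hg.continuousAt.eventually_ne h0] with z hz
    rw [Complex.exp_add, Complex.exp_log (div_ne_zero hz h0), Complex.exp_log h0,
      div_mul_cancel₀ _ h0]

theorem exists_isCBranchAt (b : ℂ) {H : ℂ → ℂ} (hH : Differentiable ℂ H) (n : ℕ) {z₀ : ℂ}
    (h0 : z₀ ≠ 0) (h1 : z₀ ≠ 1) (hH0 : H z₀ ≠ 0) : ∃ C, IsCBranchAt b H n z₀ C := by
  obtain ⟨L₀, hL₀, e₀⟩ := exists_analyticAt_log (g := fun z => z) analyticAt_id h0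
  obtain ⟨L₁, hL₁, e₁⟩ := exists_analyticAt_log (g := fun z => -z) analyticAt_id.neg
    (neg_ne_zero.2 h0)
  obtain ⟨L₂, hL₂, e₂⟩ := exists_analyticAt_log (g := fun z => 1 - z)
    (analyticAt_const.sub analyticAt_id) (sub_ne_zero.2 h1.symm)
  obtain ⟨L₃, hL₃, e₃⟩ := exists_analyticAt_log (hH.analyticAt z₀) hH0
  refine ⟨fun z => !![exp (-(n / 2 : ℂ) * L₀ z) *
      exp ((-conj b * L₁ z + (b + conj b) * L₂ z + L₃ z) / 2), 0; 0, exp ((n / 2 : ℂ) * L₀ z) *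
      (exp ((-conj b * L₁ z + (b + conj b) * L₂ z + L₃ z) / 2))⁻¹], L₀, L₁, L₂,
    fun z => exp ((-conj b * L₁ z + (b + conj b) * L₂ z + L₃ z) / 2), hL₀, hL₁, hL₂,
    by fun_prop, ?_⟩
  filter_upwards [e₀, e₁, e₂, e₃] with z e₀ e₁ e₂ e₃
  refine ⟨e₀, e₁, e₂, ?_, rfl⟩
  rw [← e₃, ← Complex.exp_nat_mul, ← Complex.exp_add, ← Complex.exp_add]
  congr 1
  push_cast
  ring

/-- The diagonal entries of any determination of `C_n` are inverse to each other and have opposite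
logarithmic derivatives, which do not depend on the determination. -/
theorem IsCBranchAt.exists_hasDerivAt {b : ℂ} {H G : ℂ → ℂ} (hH : Differentiable ℂ H)
    (hG : ∀ z, z * (1 - z) * deriv H z = G z * H z) {n : ℕ} {z₀ : ℂ} (h0 : z₀ ≠ 0) (h1 : z₀ ≠ 1)
    (hH0 : H z₀ ≠ 0) {C : ℂ → Matrix (Fin 2) (Fin 2) ℂ} (hC : IsCBranchAt b H n z₀ C) :
    ∃ c d : ℂ → ℂ, c z₀ * d z₀ = 1 ∧
      HasDerivAt c (((-n - conj b) * (1 - z₀) - (b + conj b) * z₀ + G z₀) / 2 /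
        (z₀ * (1 - z₀)) * c z₀) z₀ ∧
      HasDerivAt d (-(((-n - conj b) * (1 - z₀) - (b + conj b) * z₀ + G z₀) / 2 /
        (z₀ * (1 - z₀))) * d z₀) z₀ ∧
      ∀ᶠ z in 𝓝 z₀, C z = !![c z, 0; 0, d z] := by
  obtain ⟨L₀, L₁, L₂, r, aL₀, aL₁, aL₂, ar, hev⟩ := hC
  have h1' : 1 - z₀ ≠ 0 := sub_ne_zero.2 h1.symm
  obtain ⟨e₀, e₁, e₂, er, -⟩ := hev.self_of_nhds
  have hr : r z₀ ≠ 0 := by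
    intro h
    rw [h, zero_pow two_ne_zero] at er
    exact mul_ne_zero (mul_ne_zero (Complex.exp_ne_zero _) (Complex.exp_ne_zero _)) hH0 er.symm
  have d₀ := aL₀.differentiableAt.hasDerivAt
  have d₁ := aL₁.differentiableAt.hasDerivAt
  have d₂ := aL₂.differentiableAt.hasDerivAt
  have dr := ar.differentiableAt.hasDerivAt
  have k₀ : deriv L₀ z₀ = 1 / z₀ := by
    have := (d₀.cexp.congr_of_eventuallyEq
      (hev.mono fun z hz => hz.1.symm : (fun z => z) =ᶠ[𝓝 z₀] _)).unique (hasDerivAt_id z₀)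
    rw [e₀] at this
    field_simp
    linear_combination this
  have k₁ : deriv L₁ z₀ = 1 / z₀ := by
    have := (d₁.cexp.congr_of_eventuallyEq
      (hev.mono fun z hz => hz.2.1.symm : (fun z => -z) =ᶠ[𝓝 z₀] _)).unique (hasDerivAt_neg z₀)
    rw [e₁] at this
    field_simp
    linear_combination -this
  have k₂ : deriv L₂ z₀ = -1 / (1 - z₀) := by
    have := (d₂.cexp.congr_of_eventuallyEq
      (hev.mono fun z hz => hz.2.2.1.symm : (fun z => 1 - z) =ᶠ[𝓝 z₀] _)).unique
      ((hasDerivAt_id z₀).const_sub 1)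
    rw [e₂] at this
    field_simp
    linear_combination this
  -- The square root is differentiated through `r² = ν`; dividing by `2 r`, nonzero since `H z₀ ≠
  -- 0`, removes the sign ambiguity.
  have kr : deriv r z₀ = (-conj b * (1 - z₀) - (b + conj b) * z₀ + G z₀) / 2 /
      (z₀ * (1 - z₀)) * r z₀ := by
    have h2 := (dr.pow 2).unique (((((d₁.const_mul (-conj b)).cexp).mul
      ((d₂.const_mul (b + conj b)).cexp)).mul (hH z₀).hasDerivAt).congr_of_eventuallyEq
      (hev.mono fun z hz => hz.2.2.2.1))
    simp only [Pi.mul_apply, Nat.cast_ofNat, Nat.add_one_sub_one, pow_one] at h2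
    have e3 : deriv H z₀ = G z₀ * H z₀ / (z₀ * (1 - z₀)) := by
      rw [← hG, mul_div_cancel_left₀ _ (mul_ne_zero h0 h1')]
    rw [k₁, k₂, e3] at h2
    have h3 : 2 * r z₀ * deriv r z₀ = (-conj b * (1 - z₀) - (b + conj b) * z₀ + G z₀) /
        (z₀ * (1 - z₀)) * r z₀ ^ 2 := by
      rw [er, h2]
      field_simp
      ring
    refine mul_left_cancel₀ (mul_ne_zero two_ne_zero hr) ?_
    rw [h3]
    ring
  refine ⟨fun z => exp (-(n / 2 : ℂ) * L₀ z) * r z, fun z => exp ((n / 2 : ℂ) * L₀ z) * (r z)⁻¹,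
    ?_, ?_, ?_, hev.mono fun z hz => hz.2.2.2.2⟩
  · have : exp (-(n / 2 : ℂ) * L₀ z₀) * exp ((n / 2 : ℂ) * L₀ z₀) = 1 := by
      rw [← Complex.exp_add, neg_mul, neg_add_cancel, Complex.exp_zero]
    rw [mul_mul_mul_comm, this, mul_inv_cancel₀ hr, one_mul]
  · refine (((d₀.const_mul (-(n / 2 : ℂ))).cexp).mul dr).congr_deriv ?_
    rw [k₀, kr]
    field_simp
    ring
  · refine (((d₀.const_mul (n / 2 : ℂ)).cexp).mul (dr.inv hr)).congr_deriv ?_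
    simp only [Pi.inv_apply]
    rw [k₀, kr]
    field_simp
    ring

/-! ### Pole orders after division by `z(1-z)` -/

section Poles

theorem meromorphicOrderAt_mul_one_sub {a : ℂ} (ha : a = 0 ∨ a = 1) :
    meromorphicOrderAt (fun z : ℂ => z * (1 - z)) a = 1 := by
  have hm : MeromorphicAt (fun z : ℂ => z * (1 - z)) a := by fun_prop
  refine (meromorphicOrderAt_eq_int_iff (n := 1) hm).2 ?_
  rcases ha with rfl | rfl
  · exact ⟨fun z => 1 - z, by fun_prop, by simp, Eventually.of_forall fun z => by simp⟩
  · exact ⟨fun z => -z, by fun_prop, by simp, Eventually.of_forall fun z => by simp; ring⟩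

theorem meromorphicOrderAt_div_mul_one_sub {f : ℂ → ℂ} {a : ℂ} (hf : AnalyticAt ℂ f a)
    (ha : a = 0 ∨ a = 1) :
    MeromorphicAt (fun z => f z / (z * (1 - z))) a ∧
      meromorphicOrderAt (fun z => f z / (z * (1 - z))) a = meromorphicOrderAt f a + (-1 : ℤ) := by
  have hm : MeromorphicAt (fun z : ℂ => z * (1 - z)) a := by fun_prop
  have he : (fun z => f z / (z * (1 - z))) = f * (fun z : ℂ => z * (1 - z))⁻¹ := by
    ext z; simp [div_eq_mul_inv]
  rw [he]
  refine ⟨hf.meromorphicAt.mul hm.inv, ?_⟩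
  rw [meromorphicOrderAt_mul hf.meromorphicAt hm.inv, meromorphicOrderAt_inv,
    meromorphicOrderAt_mul_one_sub ha]
  rfl

variable {N : ℂ → Matrix (Fin 2) (Fin 2) ℂ} {a : ℂ}

theorem hasSimplePoleAt_div_mul_one_sub (hN : ∀ i j, AnalyticAt ℂ (fun z => N z i j) a)
    (ha : a = 0 ∨ a = 1) (hne : ∃ i j, N a i j ≠ 0) :
    HasSimplePoleAt (fun z => Matrix.of fun i j => N z i j / (z * (1 - z))) a := by
  refine ⟨fun i j => ?_, ?_⟩
  · obtain ⟨h1, h2⟩ := meromorphicOrderAt_div_mul_one_sub (hN i j) ha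
    refine ⟨h1, ?_⟩
    simp only [Matrix.of_apply]
    rw [h2]
    have := add_le_add_left (hN i j).meromorphicOrderAt_nonneg ((-1 : ℤ) : WithTop ℤ)
    simpa using this
  · obtain ⟨i, j, hij⟩ := hne
    refine ⟨i, j, ?_⟩
    obtain ⟨h1, h2⟩ := meromorphicOrderAt_div_mul_one_sub (hN i j) ha
    simp only [Matrix.of_apply]
    rw [h2, (hN i j).meromorphicOrderAt_eq, (hN i j).analyticOrderAt_eq_zero.2 hij]
    rfl

theorem hasRemovableSingularityAt_div_mul_one_sub (hN : ∀ i j, AnalyticAt ℂ (fun z => N z i j) a)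
    (ha : a = 0 ∨ a = 1) (hz : ∀ i j, N a i j = 0) :
    HasRemovableSingularityAt (fun z => Matrix.of fun i j => N z i j / (z * (1 - z))) a := by
  intro i j
  obtain ⟨h1, h2⟩ := meromorphicOrderAt_div_mul_one_sub (hN i j) ha
  refine ⟨h1, ?_⟩
  simp only [Matrix.of_apply]
  rw [h2]
  have h3 : (1 : ℤ) ≤ meromorphicOrderAt (fun z => N z i j) a := by
    rw [(hN i j).meromorphicOrderAt_eq]
    have h4 : analyticOrderAt (fun z => N z i j) a ≠ 0 := fun h =>
      (hN i j).analyticOrderAt_eq_zero.1 h (hz i j)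
    generalize analyticOrderAt (fun z => N z i j) a = o at h4
    cases o with
    -- An entry vanishing identically near the point has infinite order and is harmless.
    | top => simp
    | coe k =>
      have : (1 : ℤ) ≤ (k : ℤ) := by
        have : k ≠ 0 := by simpa using h4
        omega
      exact WithTop.coe_le_coe.2 this
  have := add_le_add_left h3 ((-1 : ℤ) : WithTop ℤ)
  refine le_trans ?_ this
  exact le_of_eq rfl

end Poles

/-! ### Nonvanishing of the exponent at the origin -/

/-- The exponent of `t ^ (-n) ν(t)` at the origin does not vanish, since otherwise `ν(t) / t` would
be the restriction of an entire function and the zeroth moment would be zero. -/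
theorem IsBiorthogonal.exponent_ne_zero {b : ℂ} (hb : -1 / 2 < b.re) {H E : ℂ → ℂ} {p s : ℕ}
    (hE : Differentiable ℂ E) (hfac : ∀ z, H z = z ^ p * ((z - 1) ^ s * E z))
    {Φ Ψ : ℕ → ℂ[X]} {h : ℕ → ℂ} (hΦ : IsBiorthogonal (jacobiWeight b H) Φ Ψ h) (m : ℕ) :
    -((m + 1 : ℕ) : ℂ) - conj b + p ≠ 0 := by
  intro h0
  have hb1 : b = ((p : ℝ) - ((m + 1 : ℕ) : ℝ) : ℝ) := by
    have : conj b = ((p : ℝ) - ((m + 1 : ℕ) : ℝ) : ℝ) := by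
      push_cast at h0 ⊢
      linear_combination -h0
    rw [← Complex.conj_conj b, this, Complex.conj_ofReal]
  -- Here `b` is the integer `p - (m + 1)`, and an integer above `-1/2` is nonnegative.
  have hle : m + 1 ≤ p := by
    rw [hb1, Complex.ofReal_re] at hb
    by_contra hlt
    have : (p : ℝ) + 1 ≤ ((m + 1 : ℕ) : ℝ) := by exact_mod_cast (by omega : p + 1 ≤ m + 1)
    linarith
  obtain ⟨k, rfl⟩ := Nat.exists_eq_add_of_le hle
  have hbk : b = (k : ℂ) := by
    rw [hb1]; push_cast; ring
  have horth := hΦ.orthogonal 0 0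
  rw [if_pos rfl, (Monic.natDegree_eq_zero (hΦ.monic_left 0)).1 (hΦ.degree_left 0),
    (Monic.natDegree_eq_zero (hΦ.monic_right 0)).1 (hΦ.degree_right 0)] at horth
  refine hΦ.norm_ne_zero 0 (horth.symm.trans ?_)
  -- With `b = k` and `p = m + 1 + k`, the zero of `H` at 0 absorbs both `(-z)^{-k}` and the `1/z`
  -- of the measure, so Cauchy's theorem applies.
  have hint : (∮ z in C(0, 1), (-1) ^ k * (1 - z) ^ (2 * k) * z ^ m * (z - 1) ^ s * E z / I)
      = 0 := by
    refine Complex.circleIntegral_eq_zero_of_differentiable_on_off_countable zero_le_one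
      Set.countable_empty (Continuous.continuousOn ?_) fun z _ => ?_
    · have := hE.continuous
      fun_prop
    · have := hE z
      fun_prop
  refine Eq.trans (circleIntegral.integral_congr zero_le_one fun t ht => ?_) hint
  have ht0 : t ≠ 0 := by rintro rfl; simp at ht
  have e1 : b + conj b = ((2 * k : ℕ) : ℂ) := by
    rw [hbk]; simp; ring
  have e2 : -conj b = -(k : ℂ) := by rw [hbk]; simp
  have hI := I_ne_zero
  simp only [eval_one, map_one]
  rw [jacobiWeight, e1, e2, Complex.cpow_neg, Complex.cpow_natCast, Complex.cpow_natCast, hfac,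
    neg_pow t k]
  have hsq : ((-1 : ℂ) ^ k) * (-1) ^ k = 1 := by
    rw [← mul_pow]; simp
  have hinv : ((-1 : ℂ) ^ k)⁻¹ = (-1) ^ k := inv_eq_of_mul_eq_one_left hsq
  rw [mul_inv, hinv]
  field_simp
  ring

/-! ### Assembling the structure matrix -/

theorem mul_fin_two_diag_apply_zero (Y : Matrix (Fin 2) (Fin 2) ℂ) (c d : ℂ) (i : Fin 2) :
    (Y * !![c, 0; 0, d]) i 0 = Y i 0 * c := by
  simp [Matrix.mul_apply, Fin.sum_univ_two]

theorem mul_fin_two_diag_apply_one (Y : Matrix (Fin 2) (Fin 2) ℂ) (c d : ℂ) (i : Fin 2) :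
    (Y * !![c, 0; 0, d]) i 1 = Y i 1 * d := by
  simp [Matrix.mul_apply, Fin.sum_univ_two]

/-- The logarithmic derivative of `Y C` for a unimodular `Y` and a diagonal unimodular `C`. -/
theorem matDeriv_mul_mul_inv {Y C : ℂ → Matrix (Fin 2) (Fin 2) ℂ} {Y' m : Matrix (Fin 2) (Fin 2) ℂ}
    {c d : ℂ → ℂ} {z₀ v : ℂ} (hcd : c z₀ * d z₀ = 1) (hc : HasDerivAt c (v * c z₀) z₀)
    (hd : HasDerivAt d (-v * d z₀) z₀) (hC : ∀ᶠ z in 𝓝 z₀, C z = !![c z, 0; 0, d z])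
    (hY : ∀ i j, HasDerivAt (fun z => Y z i j) (Y' i j) z₀) (hdet : (Y z₀).det = 1)
    (hm0 : ∀ i, m i 0 * Y z₀ 0 0 + m i 1 * Y z₀ 1 0 = Y' i 0 + v * Y z₀ i 0)
    (hm1 : ∀ i, m i 0 * Y z₀ 0 1 + m i 1 * Y z₀ 1 1 = Y' i 1 - v * Y z₀ i 1) :
    m = matDeriv (fun z => Y z * C z) z₀ * (Y z₀ * C z₀)⁻¹ := by
  have hC0 := hC.self_of_nhds
  have hu : IsUnit (Y z₀ * C z₀).det := by
    rw [Matrix.det_mul, hdet, hC0, Matrix.det_fin_two_of, hcd]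
    simp
  have key : m * (Y z₀ * C z₀) = matDeriv (fun z => Y z * C z) z₀ := by
    ext i j
    rw [Matrix.mul_apply, Fin.sum_univ_two, hC0, matDeriv, Matrix.of_apply]
    have hev : (fun z => (Y z * C z) i j) =ᶠ[𝓝 z₀] fun z => (Y z * !![c z, 0; 0, d z]) i j := by
      filter_upwards [hC] with z hz
      rw [hz]
    rw [hev.deriv_eq]
    fin_cases j
    · simp only [Fin.zero_eta, mul_fin_two_diag_apply_zero]
      rw [((hY i 0).fun_mul hc).deriv]
      linear_combination c z₀ * hm0 i
    · simp only [Fin.mk_one, mul_fin_two_diag_apply_one]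
      rw [((hY i 1).fun_mul hd).deriv]
      linear_combination d z₀ * hm1 i
  rw [← key, Matrix.mul_nonsing_inv_cancel_right _ _ hu]

/-- The entire matrix function `z (1 - z) M_n(z)`. -/
noncomputable def structureNumerator (w V P R : ℂ → ℂ) (κ c : ℂ) (z : ℂ) :
    Matrix (Fin 2) (Fin 2) ℂ :=
  !![κ * c * pearsonBilin w V P R z, -c * pearsonBilin w V P P z;
     κ ^ 2 * c * pearsonBilin w V R R z, -κ * c * pearsonBilin w V R P z]

theorem differentiable_structureNumerator {w V P R : ℂ → ℂ} (hw : CircleIntegrable w 0 1)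
    (hV : Differentiable ℂ V) (hP : Differentiable ℂ P) (hR : Differentiable ℂ R) (κ c : ℂ)
    (i j : Fin 2) : Differentiable ℂ fun z => structureNumerator w V P R κ c z i j := by
  fin_cases i <;> fin_cases j <;>
    exact (differentiable_pearsonBilin hw hV (by assumption) (by assumption)).const_mul _

/-- The logarithmic derivative of `H` has at most simple poles, at 0 and 1, with residues `p` and
`s`; the factor `z(1-z)` clears them and leaves the value `p` at 0. -/
theorem exists_logDeriv_numerator {H : ℂ → ℂ} {E : ℂ → ℂ} {p s : ℕ} (hE : Differentiable ℂ E)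
    (hE0 : ∀ z, E z ≠ 0) (hfac : ∀ z, H z = z ^ p * ((z - 1) ^ s * E z)) :
    ∃ G : ℂ → ℂ, Differentiable ℂ G ∧ G 0 = p ∧
      ∀ z, z * (1 - z) * deriv H z = G z * H z := by
  have hE' := hE.deriv
  refine ⟨fun z => p * (1 - z) - s * z + z * (1 - z) * (deriv E z / E z), ?_, by simp, fun z => ?_⟩
  · exact ((by fun_prop : Differentiable ℂ fun z : ℂ => p * (1 - z) - s * z)).add
      ((by fun_prop : Differentiable ℂ fun z : ℂ => z * (1 - z)).mul (hE'.div hE hE0))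
  · have hd : HasDerivAt H (p * z ^ (p - 1) * ((z - 1) ^ s * E z) + z ^ p *
        (s * (z - 1) ^ (s - 1) * E z + (z - 1) ^ s * deriv E z)) z := by
      rw [funext hfac]
      have h1 := ((hasDerivAt_id z).sub_const 1).pow s
      refine ((hasDerivAt_pow p z).mul (h1.mul (hE z).hasDerivAt)).congr_deriv ?_
      simp
    have e1 : (p : ℂ) * z ^ (p - 1) * z = p * z ^ p := by
      rcases p with _ | p
      · simp
      · rw [Nat.add_sub_cancel, pow_succ]; ring
    have e2 : (s : ℂ) * (z - 1) ^ (s - 1) * (z - 1) = s * (z - 1) ^ s := by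
      rcases s with _ | s
      · simp
      · rw [Nat.add_sub_cancel, pow_succ]; ring
    rw [hd.deriv, hfac]
    have := hE0 z
    field_simp
    linear_combination (1 - z) * (z - 1) ^ s * E z * e1 - z * z ^ p * E z * e2

theorem mainTheorem10 (b : ℂ) (hb : -1 / 2 < b.re)
    (H : ℂ → ℂ) (hH : Differentiable ℂ H) (hH0 : ∀ z, z ≠ 0 → z ≠ 1 → H z ≠ 0)
    (Φ Ψ : ℕ → ℂ[X]) (h : ℕ → ℂ) (hΦ : IsBiorthogonal (jacobiWeight b H) Φ Ψ h)
    (n : ℕ) (hn : 1 ≤ n) :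
    ∃ M : ℂ → Matrix (Fin 2) (Fin 2) ℂ,
      (∀ z, ‖z‖ ≠ 1 → z ≠ 0 → IsStructureMatrixAt b H Φ Ψ h n z (M z)) ∧
      (∀ i j, DifferentiableOn ℂ (fun z => M z i j) {0, 1}ᶜ) ∧
      HasSimplePoleAt M 0 ∧
      (HasRemovableSingularityAt M 1 ∨ HasSimplePoleAt M 1) := by
  obtain ⟨m, rfl⟩ : ∃ m, n = m + 1 := ⟨n - 1, by omega⟩
  obtain ⟨p, s, E, hE, hE0, hfac⟩ := exists_eq_pow_mul_pow_mul_entire hH hH0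
  obtain ⟨G, hGd, hGp, hG⟩ := exists_logDeriv_numerator hE hE0 hfac
  have hν : CircleIntegrable (jacobiWeight b H) 0 1 := by
    have : jacobiDensity b H 0 = jacobiWeight b H := funext fun t => by simp [jacobiDensity]
    simpa [this] using circleIntegrable_jacobiDensity hb hH.continuous 0
  have hw : CircleIntegrable (jacobiDensity b H (m + 1)) 0 1 :=
    circleIntegrable_jacobiDensity hb hH.continuous (m + 1)
  set w : ℂ → ℂ := jacobiDensity b H (m + 1)
  set V : ℂ → ℂ := fun t => (-((m + 1 : ℕ) : ℂ) - conj b) * (1 - t) - (b + conj b) * t + G t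
    with hVdef
  have hV : Differentiable ℂ V := by fun_prop
  have hparts : ∀ f : ℂ → ℂ, (∀ t ∈ Metric.sphere (0 : ℂ) 1, AnalyticAt ℂ f t) →
      (∮ t in C(0, 1), ((1 - 2 * t) * f t + t * (1 - t) * deriv f t + V t * f t) * w t) = 0 :=
    fun f hf => integral_by_parts_jacobiDensity hb hH hGd.continuous hG (m + 1) hf
  set P : ℂ → ℂ := fun t => (Φ (m + 1)).eval t
  set R : ℂ → ℂ := fun t => (recip m (Ψ m)).eval t
  have hP : Differentiable ℂ P := (Φ (m + 1)).differentiable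
  have hR : Differentiable ℂ R := (recip m (Ψ m)).differentiable
  set κ : ℂ := -(2 * Real.pi / h m) with hκ
  set c : ℂ := (2 * Real.pi * I)⁻¹ with hc
  set N := structureNumerator w V P R κ c with hN
  have hNd : ∀ i j, Differentiable ℂ fun z => N z i j :=
    differentiable_structureNumerator hw hV hP hR κ c
  have hdet : ∀ z : ℂ, ‖z‖ ≠ 1 →
      κ * c * (P z * cauchyTransform w R z - R z * cauchyTransform w P z) = 1 := by
    intro z hz
    have h1 := hΦ.wronskian hν m hw hz
    have h2 : P z * cauchyTransform w R z - R z * cauchyTransform w P z = -(I * h m) := h1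
    have h3 := hΦ.norm_ne_zero m
    have h4 : (Real.pi : ℂ) ≠ 0 := ofReal_ne_zero.2 Real.pi_ne_zero
    have h5 := I_ne_zero
    rw [h2, hκ, hc]
    field_simp
  have hY : ∀ z, Ymat (jacobiWeight b H) Φ Ψ h (m + 1) z = !![P z, c * cauchyTransform w P z;
      κ * R z, κ * (c * cauchyTransform w R z)] := fun z => rfl
  have hB : ∀ {f g : ℂ → ℂ} (_ : Differentiable ℂ f) (_ : Differentiable ℂ g) {z : ℂ}
      (_ : ‖z‖ ≠ 1), pearsonBilin w V f g z = z * (1 - z) * (deriv f z * cauchyTransform w g z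
      - deriv (cauchyTransform w f) z * g z)
      + V z / 2 * (f z * cauchyTransform w g z + cauchyTransform w f z * g z) :=
    fun hf hg _ hz => pearsonBilin_eq hw hV.continuous hparts hf hg hz
  refine ⟨fun z => Matrix.of fun i j => N z i j / (z * (1 - z)), ?_, ?_, ?_, ?_⟩
  · intro z hz hz0
    have hz1 : z ≠ 1 := by rintro rfl; simp at hz
    have hz1' : 1 - z ≠ 0 := sub_ne_zero.2 hz1.symm
    refine ⟨exists_isCBranchAt b hH (m + 1) hz0 hz1 (hH0 z hz0 hz1), fun C hC => ?_⟩
    obtain ⟨γ, δ, hγδ, hγ, hδ, hCev⟩ := hC.exists_hasDerivAt hH hG hz0 hz1 (hH0 z hz0 hz1)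
    have dP := (hP z).hasDerivAt
    have dR := (hR z).hasDerivAt
    have dFP := (hasDerivAt_cauchyTransform hw hP.continuous hz).differentiableAt.hasDerivAt
    have dFR := (hasDerivAt_cauchyTransform hw hR.continuous hz).differentiableAt.hasDerivAt
    have hd := hdet z hz
    have b1 := hB hP hR hz
    have b2 := hB hP hP hz
    have b3 := hB hR hR hz
    have b4 := hB hR hP hz
    have hq : z * (1 - z) ≠ 0 := mul_ne_zero hz0 hz1'
    have hv : ∀ y, V z * y / 2 / (z * (1 - z)) * (z * (1 - z)) = V z * y / 2 :=
      fun y => div_mul_cancel₀ _ hq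
    replace hγ : HasDerivAt γ (V z / 2 / (z * (1 - z)) * γ z) z := hγ
    replace hδ : HasDerivAt δ (-(V z / 2 / (z * (1 - z))) * δ z) z := hδ
    clear_value V κ c
    refine matDeriv_mul_mul_inv (Y' := !![deriv P z, c * deriv (cauchyTransform w P) z;
      κ * deriv R z, κ * (c * deriv (cauchyTransform w R) z)]) (v := V z / 2 / (z * (1 - z)))
      hγδ hγ hδ hCev ?_ ?_ ?_ ?_
    · intro i j
      simp only [hY]
      fin_cases i <;> fin_cases j
      · exact dP
      · exact dFP.const_mul c
      · exact dR.const_mul κ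
      · exact (dFR.const_mul c).const_mul κ
    · rw [hY, Matrix.det_fin_two_of]
      linear_combination hd
    · intro i
      rw [hY]
      simp only [Matrix.of_apply, div_mul_eq_mul_div]
      rw [← add_div, div_eq_iff hq, add_mul, hv]
      fin_cases i
      · simp only [hN, structureNumerator, Fin.zero_eta, Matrix.of_apply, Matrix.cons_val',
          Matrix.cons_val_zero, Matrix.cons_val_one, Matrix.cons_val_fin_one, b1, b2]
        -- In `N Y` the terms regroup as `q Y' + (V/2) Y diag(1,-1)` times `det Y`, and `det Y = 1`.
        linear_combination (z * (1 - z) * deriv P z + V z / 2 * P z) * hd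
      · simp only [hN, structureNumerator, Fin.mk_one, Matrix.of_apply, Matrix.cons_val',
          Matrix.cons_val_zero, Matrix.cons_val_one, Matrix.cons_val_fin_one, b3, b4]
        linear_combination κ * (z * (1 - z) * deriv R z + V z / 2 * R z) * hd
    · intro i
      rw [hY]
      simp only [Matrix.of_apply, div_mul_eq_mul_div]
      rw [← add_div, div_eq_iff hq, sub_mul, hv]
      fin_cases i
      · simp only [hN, structureNumerator, Fin.zero_eta, Matrix.of_apply, Matrix.cons_val',
          Matrix.cons_val_zero, Matrix.cons_val_one, Matrix.cons_val_fin_one, b1, b2]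
        linear_combination c * (z * (1 - z) * deriv (cauchyTransform w P) z
          - V z / 2 * cauchyTransform w P z) * hd
      · simp only [hN, structureNumerator, Fin.mk_one, Matrix.of_apply, Matrix.cons_val',
          Matrix.cons_val_zero, Matrix.cons_val_one, Matrix.cons_val_fin_one, b3, b4]
        linear_combination κ * c * (z * (1 - z) * deriv (cauchyTransform w R) z
          - V z / 2 * cauchyTransform w R z) * hd
  · intro i j
    refine (hNd i j).differentiableOn.div (by fun_prop) fun z hz => ?_
    simp only [Set.mem_compl_iff, Set.mem_insert_iff, Set.mem_singleton_iff, not_or] at hz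
    exact mul_ne_zero hz.1 (sub_ne_zero.2 (Ne.symm hz.2))
  · refine hasSimplePoleAt_div_mul_one_sub (fun i j => (hNd i j).analyticAt 0) (Or.inl rfl) ?_
    by_contra! hall
    have h0 : ‖(0 : ℂ)‖ ≠ 1 := by simp
    have hd := hdet 0 h0
    have hV0 : V 0 ≠ 0 := by
      have := hΦ.exponent_ne_zero hb hE hfac m
      simpa [hVdef, hGp] using this
    have a00 : κ * c * pearsonBilin w V P R 0 = 0 := hall 0 0
    have a01 : -c * pearsonBilin w V P P 0 = 0 := hall 0 1
    have a10 : κ ^ 2 * c * pearsonBilin w V R R 0 = 0 := hall 1 0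
    rw [hB hP hR h0, zero_mul, zero_mul, zero_add] at a00
    rw [hB hP hP h0, zero_mul, zero_mul, zero_add] at a01
    rw [hB hR hR h0, zero_mul, zero_mul, zero_add] at a10
    clear_value V κ c
    -- At 0 the diagonal entries of `N` are opposite, so `-det N(0) = N₀₀² + N₀₁ N₁₀`, which equals
    -- `(V(0)/2)² (det Y(0))²`. With all entries zero, `V(0)` would vanish.
    have hsq : (V 0 / 2) ^ 2 = 0 := by
      linear_combination (κ * c * (V 0 / 2 * (P 0 * cauchyTransform w R 0 +
          cauchyTransform w P 0 * R 0))) * a00 + (κ ^ 2 * c * (V 0 / 2 *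
          (R 0 * cauchyTransform w R 0 + cauchyTransform w R 0 * R 0))) * a01 -
        (V 0 / 2) ^ 2 * (κ * c * (P 0 * cauchyTransform w R 0 - R 0 * cauchyTransform w P 0) + 1)
          * hd
    exact hV0 (by simpa using hsq)
  · by_cases hall : ∀ i j, N 1 i j = 0
    · exact Or.inl (hasRemovableSingularityAt_div_mul_one_sub
        (fun i j => (hNd i j).analyticAt 1) (Or.inr rfl) hall)
    · push Not at hall
      exact Or.inr (hasSimplePoleAt_div_mul_one_sub
        (fun i j => (hNd i j).analyticAt 1) (Or.inr rfl) hall)
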